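/- **Theorem (Aizenman–Nachtergaele representation of the Heisenberg antiferromagnet).** Let $\Lambda=(\mathcal V,\mathcal E)$ be a finite simple graph that is bipartite: $\mathcal V$ is the disjoint union of $\mathcal V_A$ and $\mathcal V_B$, and every edge joins $\mathcal V_A$ to $\mathcal V_B$. Put $(-1)^x=1$ for $x\in\mathcal V_A$ and $(-1)^x=-1$ for $x\in\mathcal V_B$. On $\bigotimes_{x\in\mathcal V}\mathbb C^2$ let $S_x^{(i)}$ ($i=1,2,3$) be the spin-$\frac12$ operators (half the Pauli matrices acting at site $x$), let $\vec S_x\cdot\vec S_y=\sum_i S^{(i)}_xS^{(i)}_y$, and for $h\in\mathbb R$ let $$H=\sum_{\{x,y\}\in\mathcal E}\vec S_x\cdot\vec S_y-h\sum_{x\in\mathcal V}S_x^{(3)},\qquad Z(\beta,h)=\operatorname{Tr}e^{-\beta H},\qquad \langle O\rangle_{\beta,h}=\frac{\operatorname{Tr}\,O\,e^{-\beta H}}{Z(\beta,h)} .$$ Let $\beta>0$ and let $\rho$ be the probability law of independent unit-intensity Poisson processes on $[0,\beta]$, one for each edge of $\Lambda$. A realization is $\omega=((e_1,t_1),\dots,(e_k,t_k))$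 with $0<t_1<\dots<t_k<\beta$; its elements are called bridges. (The number $k$ is Poisson of mean $\beta|\mathcal E|$; given $k$, the times are uniform on $\{0<t_1<\dots<t_k<\beta\}$ and the edges are independent and uniform on $\mathcal E$.) The loops of $\omega$ are the closed trajectories on the cylinder $\mathcal V\times[0,\beta]_{\rm per}$ that move with unit speed upwards in time on $\mathcal V_A$ and downwards in time on $\mathcal V_B$, and that, whenever they meet a bridge $(\{x,y\},t)$ at $(x,t)$, jump to $(y,t)$ and continue there in the opposite time direction. Trajectories with the same support are identified, so that the set $\mathcal L(\omega)$ of loops is a partition of the cylinder. Let $\gamma_x$ be the loop containing $(x,0)$, and let $w(\gamma)\in\mathbb Z$ be the winding number of $\gamma$ around the time direction, i.e. the number of its upward passages through $\{t=0\}$ minus the number of its downward passages. Write $W(\omega)=\prod_{\gamma\in\mathcal L(\omega)}2\cosh(\beta h\,w(\gamma))$. Then, for every $\beta>0$, $h\in\mathbb R$ and $x,y\in\mathcal V$, all integrands below are $\rho$-integrable and $$Z(2\beta,h)=e^{\frac\beta2|\mathcal E|}\int W(\omega)\,d\rho(\omega),$$ $$\operatorname{Tr}S_x^{(3)}e^{-2\beta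 H}=\tfrac12(-1)^x e^{\frac\beta2|\mathcal E|}\int \tanh(\beta h\,w(\gamma_x))\,W(\omega)\,d\rho(\omega),$$ $$\operatorname{Tr}S_x^{(3)}S_y^{(3)}e^{-2\beta H}=\tfrac14(-1)^x(-1)^y e^{\frac\beta2|\mathcal E|}\int W(\omega)\,\times\begin{cases}1&\text{if }\gamma_x=\gamma_y\\ \tanh(\beta h\,w(\gamma_x))\tanh(\beta h\,w(\gamma_y))&\text{if }\gamma_x\ne\gamma_y\end{cases}\;d\rho(\omega).$$ In particular, at $h=0$, $$(-1)^x(-1)^y\,\langle S_x^{(3)}S_y^{(3)}\rangle_{2\beta,0}=\tfrac14\,\mathbb P^{\rm loops}(\gamma_x=\gamma_y),$$ where $\mathbb P^{\rm loops}$ is the probability measure proportional to $2^{|\mathcal L(\omega)|}\,\rho(d\omega)$. -/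

import Mathlib

open MeasureTheory ProbabilityTheory
open scoped ENNReal

noncomputable section

namespace Heisenberg

variable {V : Type*} [Fintype V] [DecidableEq V]

/-! ### Spin operators and the Heisenberg antiferromagnet

The basis vectors of `ℂ²` are labelled by `Fin 2`, where `0` is spin `1/2` and `1` is spin `-1/2`.
The basis of the tensor product over `V` is labelled by spin configurations `V → Fin 2`, and
operators on the tensor product are matrices in this basis. -/

/-- The tensor product `⊗ₓ a x` of operators on the one-site spaces. -/
def tensorOp (a : V → Matrix (Fin 2) (Fin 2) ℂ) : Matrix (V → Fin 2) (V → Fin 2) ℂ :=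
  Matrix.of fun s s' => ∏ x, a x (s x) (s' x)

/-- The operator that acts as `a` on site `x` and as the identity on all other sites. -/
def siteOp (x : V) (a : Matrix (Fin 2) (Fin 2) ℂ) : Matrix (V → Fin 2) (V → Fin 2) ℂ :=
  tensorOp (Function.update (fun _ => 1) x a)

/-- The spin-1/2 matrices `S⁽¹⁾, S⁽²⁾, S⁽³⁾`. -/
def pauli : Fin 3 → Matrix (Fin 2) (Fin 2) ℂ :=
  ![(1 / 2 : ℂ) • !![0, 1; 1, 0],
    (1 / 2 : ℂ) • !![0, -Complex.I; Complex.I, 0],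
    (1 / 2 : ℂ) • !![1, 0; 0, -1]]

/-- The spin operator in the direction `i` at site `x`. -/
def spin (i : Fin 3) (x : V) : Matrix (V → Fin 2) (V → Fin 2) ℂ :=
  siteOp x (pauli i)

/-- The third spin component at site `x`. -/
abbrev spin₃ (x : V) : Matrix (V → Fin 2) (V → Fin 2) ℂ := spin 2 x

/-- `S_x · S_y`. -/
def spinDot (x y : V) : Matrix (V → Fin 2) (V → Fin 2) ℂ :=
  ∑ i, spin i x * spin i y

theorem tensorOp_mul (a b : V → Matrix (Fin 2) (Fin 2) ℂ) :
    tensorOp a * tensorOp b = tensorOp (fun x => a x * b x) := by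
  ext s s'
  simp only [tensorOp, Matrix.mul_apply, Matrix.of_apply, ← Finset.prod_mul_distrib]
  rw [Fintype.prod_sum]

theorem spinDot_comm (x y : V) : spinDot x y = spinDot y x := by
  refine Finset.sum_congr rfl fun i _ => ?_
  simp only [spin, siteOp, tensorOp_mul]
  congr 1
  funext z
  by_cases hx : z = x <;> by_cases hy : z = y <;> simp [Function.update_apply, hx, hy]

/-- `S_x · S_y` as a function of the unordered pair `{x, y}`. -/
def bondOp (e : Sym2 V) : Matrix (V → Fin 2) (V → Fin 2) ℂ :=
  Sym2.lift ⟨spinDot, spinDot_comm⟩ e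

/-- The Hamiltonian of the Heisenberg antiferromagnet on `G` with external field `h`. -/
def hamiltonian (G : SimpleGraph V) [DecidableRel G.Adj] (h : ℝ) :
    Matrix (V → Fin 2) (V → Fin 2) ℂ :=
  ∑ e ∈ G.edgeFinset, bondOp e - (h : ℂ) • ∑ x, spin₃ x

/-- The operator `exp(-β H)`. -/
def gibbsOp (G : SimpleGraph V) [DecidableRel G.Adj] (β h : ℝ) :
    Matrix (V → Fin 2) (V → Fin 2) ℂ :=
  NormedSpace.exp (-(β : ℂ) • hamiltonian G h)

/-- The partition function `Z(β, h) = Tr exp(-β H)`. -/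
def partitionFunction (G : SimpleGraph V) [DecidableRel G.Adj] (β h : ℝ) : ℂ :=
  (gibbsOp G β h).trace

/-- The Gibbs state `⟨O⟩ = Tr (O exp(-β H)) / Z(β, h)`. -/
def gibbsState (G : SimpleGraph V) [DecidableRel G.Adj] (β h : ℝ)
    (O : Matrix (V → Fin 2) (V → Fin 2) ℂ) : ℂ :=
  (O * gibbsOp G β h).trace / partitionFunction G β h

/-! ### The Poisson edge process -/

/-- A finite sequence of bridges `((e₁, t₁), …, (e_k, t_k))`: the number `k`, the edges
and the times. -/
abbrev BridgeConfig (G : SimpleGraph V) : Type _ :=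
  Σ k : ℕ, (Fin k → G.edgeSet) × (Fin k → ℝ)

/-- The finite set of edges carries the discrete σ-algebra. -/
instance edgeMeasurableSpace (G : SimpleGraph V) : MeasurableSpace G.edgeSet := ⊤

/-- The set `{0 < t₁ < ⋯ < t_k < β}`. -/
def orderedTimes (k : ℕ) (β : ℝ) : Set (Fin k → ℝ) :=
  {t | StrictMono t ∧ ∀ i, 0 < t i ∧ t i < β}

/-- The law of independent Poisson processes of unit intensity on `[0, β]`, one for each edge,
listed in order of time. The total number of bridges is Poisson of mean `β |E|`; given that there
are `k` bridges, their edges are independent and uniform, and, independently, their times are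
uniform in `{0 < t₁ < ⋯ < t_k < β}`. -/
def poissonEdgeMeasure (G : SimpleGraph V) [DecidableRel G.Adj] (β : ℝ) :
    Measure (BridgeConfig G) :=
  Measure.sum fun k : ℕ =>
    poissonMeasure (β * G.edgeFinset.card).toNNReal {k} •
      ((uniformOn (Set.univ : Set (Fin k → G.edgeSet))).prod
        (volume[|orderedTimes k β])).map (Sigma.mk k)

/-! ### Loops -/

/-- `ω` has a bridge between `x` and `y` at time `t`. -/
def HasBridge {G : SimpleGraph V} (ω : BridgeConfig G) (x y : V) (t : ℝ) : Prop :=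
  ∃ i : Fin ω.1, (ω.2.1 i : Sym2 V) = s(x, y) ∧ ω.2.2 i = t

/-- `ω` has a bridge with endpoint `x` at time `t`. -/
def BridgeAt {G : SimpleGraph V} (ω : BridgeConfig G) (x : V) (t : ℝ) : Prop :=
  ∃ y, HasBridge ω x y t

/-- The pieces of the trajectories that make up the loops, on the cylinder
`V × [0, β]_per = V × ℝ/βℤ`. Trajectories move upwards in time on the sublattice `A` and downwards
on its complement. On meeting a bridge they cross it, arriving on the other sublattice and hence
reversing their direction of time. At the crossing a trajectory takes the value it had before
the jump. -/
inductive Move (A : Set V) {G : SimpleGraph V} {β : ℝ} (ω : BridgeConfig G) :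
    V × AddCircle β → V × AddCircle β → Prop
  /-- Motion upwards from time `s` to time `t`, meeting no bridge in `[s, t)`. -/
  | up {x : V} {s t : ℝ} (hx : x ∈ A) (h0 : 0 ≤ s) (hst : s < t) (h1 : t ≤ β)
      (hfree : ∀ r, s ≤ r → r < t → ¬ BridgeAt ω x r) :
      Move A ω (x, (s : AddCircle β)) (x, (t : AddCircle β))
  /-- Motion downwards from time `s` to time `t`, meeting no bridge in `(t, s]`. -/
  | down {x : V} {s t : ℝ} (hx : x ∉ A) (h0 : 0 ≤ t) (hst : t < s) (h1 : s ≤ β)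
      (hfree : ∀ r, t < r → r ≤ s → ¬ BridgeAt ω x r) :
      Move A ω (x, (s : AddCircle β)) (x, (t : AddCircle β))
  /-- Crossing a bridge at time `s` from `x` to `y`, then motion upwards to time `t`. -/
  | crossUp {x y : V} {s t : ℝ} (hx : x ∉ A) (hy : y ∈ A) (hb : HasBridge ω x y s)
      (h0 : 0 ≤ s) (hst : s < t) (h1 : t ≤ β)
      (hfree : ∀ r, s < r → r < t → ¬ BridgeAt ω y r) :
      Move A ω (x, (s : AddCircle β)) (y, (t : AddCircle β))
  /-- Crossing a bridge at time `s` from `x` to `y`, then motion downwards to time `t`. -/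
  | crossDown {x y : V} {s t : ℝ} (hx : x ∈ A) (hy : y ∉ A) (hb : HasBridge ω x y s)
      (h0 : 0 ≤ t) (hst : t < s) (h1 : s ≤ β)
      (hfree : ∀ r, t < r → r < s → ¬ BridgeAt ω y r) :
      Move A ω (x, (s : AddCircle β)) (y, (t : AddCircle β))

/-- The set of loops of `ω`. A loop is identified with its support, so the loops are
the classes of the partition of the cylinder by the relation of lying on a common trajectory. -/
def Loops (A : Set V) {G : SimpleGraph V} (β : ℝ) (ω : BridgeConfig G) : Type _ :=
  Quot (Move A (β := β) ω)

/-- The loop through `(x, 0)`. -/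
def loopAt (A : Set V) {G : SimpleGraph V} (β : ℝ) (ω : BridgeConfig G) (x : V) :
    Loops A β ω :=
  Quot.mk _ (x, 0)

open Classical in
/-- `(-1)^x`, which is `1` on the sublattice `A` and `-1` on its complement. -/
def sgn (A : Set V) (x : V) : ℤ := if x ∈ A then 1 else -1

open Classical in
/-- The winding number of a loop around the time direction of the cylinder: the number of times
that it goes upwards through `{t = 0}` minus the number of times that it goes downwards. -/
def winding (A : Set V) {G : SimpleGraph V} (β : ℝ) (ω : BridgeConfig G) (γ : Loops A β ω) : ℤ :=
  ∑ x, if loopAt A β ω x = γ then sgn A x else 0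

/-- The weight `∏_γ 2 cosh(β h w(γ))`. -/
def loopWeight (A : Set V) {G : SimpleGraph V} (β h : ℝ) (ω : BridgeConfig G) : ℝ :=
  ∏ᶠ γ : Loops A β ω, 2 * Real.cosh (β * h * winding A β ω γ)

/-- `tanh(β h w(γ_x))`. -/
def tanhAt (A : Set V) {G : SimpleGraph V} (β h : ℝ) (ω : BridgeConfig G) (x : V) : ℝ :=
  Real.tanh (β * h * winding A β ω (loopAt A β ω x))

open Classical in
/-- The factor `1` if `γ_x = γ_y`, and `tanh(β h w(γ_x)) tanh(β h w(γ_y))` otherwise. -/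
def pairFactor (A : Set V) {G : SimpleGraph V} (β h : ℝ) (ω : BridgeConfig G) (x y : V) : ℝ :=
  if loopAt A β ω x = loopAt A β ω y then 1 else tanhAt A β h ω x * tanhAt A β h ω y

/-- The loop measure at zero field: the Poisson edge measure weighted by `2 ^ (number of loops)`
and normalized. -/
def loopMeasure (A : Set V) (G : SimpleGraph V) [DecidableRel G.Adj] (β : ℝ) :
    Measure (BridgeConfig G) :=
  (∫⁻ ω, 2 ^ Nat.card (Loops A β ω) ∂(poissonEdgeMeasure G β))⁻¹ •
    (poissonEdgeMeasure G β).withDensity fun ω => 2 ^ Nat.card (Loops A β ω)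

end Heisenberg

end

/-!
The Poisson edge process is a device for expanding an exponential. Rotate the spins on the
complement of `A` by `π` about the third axis. Then `-2 S_u · S_v` becomes `M - 1/2`, where `M` is
the `0`-`1` matrix `bridgeMatrix` whose nonzero entries join the spin configurations that agree off
the bond and are antiparallel on it (`bondOp_apply`). The bridges conserve the total third spin
component, so the field factors out of the Gibbs operator, and the trace of a diagonal observable
against it is a weighted trace of `exp (β ∑ M)` (`trace_diagonal_mul_gibbsOp`). Expanding the
exponential in powers gives `∑ β ^ k / k!` times the sum, over all sequences of `k` edges, of the
trace of the product of their matrices (`hasSum_bridgeTrace`). Up to the factor `exp (-β |E|)` this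
is the integral over the Poisson edge process of that trace, because for ordered bridges the
integrand depends only on the order of the edges (`hasSum_integral_poissonEdgeMeasure`).

It remains to express the trace of a product of bridge matrices through loops. It is a sum over
the paths of spin configurations that are periodic in time and jump only at the bridges. In terms
of staggered spins, which are reversed off `A`, the matrix elements of a bridge say that, on either
side of it in time, the spins at its two ends are equal: the staggered spin is constant along the
trajectories that cross the bridge. Thus the paths are the functions on the cylinder that are
constant on loops, i.e. the independent assignments of spins to the loops
(`exists_loopSpins_equiv`). The total third component at time `0` is half the sum over the loops of
spin times winding number (`fieldWeight_stagger`), so the sum over the spin of each loop produces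
the factor `2 cosh`, and `2 sinh` when a spin is observed on the loop
(`sum_prod_spinSign_mul_exp`). At zero field `tanh` vanishes and only the event that both sites lie
on one loop survives.
-/

noncomputable section

namespace Heisenberg

/-! ### Passage of bridges in time -/

section Passage

variable {V : Type*} {A : Set V} {k : ℕ} {t : Fin k → ℝ}

/-- A trajectory standing at the space-time point `(x, τ)` is above the `i`-th bridge. At the
instant of the bridge a trajectory carries the value it had before the jump: on `A` it comes from
below, on the complement of `A` from above. -/
def Passed (A : Set V) (t : Fin k → ℝ) (x : V) (τ : ℝ) (i : Fin k) : Prop :=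
  t i < τ ∨ (x ∉ A ∧ t i = τ)

theorem Passed.of_le (ht : StrictMono t) {x : V} {τ : ℝ} {i j : Fin k} (h : Passed A t x τ i)
    (hji : j ≤ i) : Passed A t x τ j := by
  rcases hji.lt_or_eq with hlt | rfl
  · have := ht hlt
    rcases h with h | ⟨_, h⟩
    · exact Or.inl (this.trans h)
    · exact Or.inl (by linarith)
  · exact h

open Classical in
/-- The number of bridges below `(x, τ)` in the sense of `Passed`, which is the index of the time
slice that `(x, τ)` belongs to. -/
def slice (A : Set V) (t : Fin k → ℝ) (x : V) (τ : ℝ) : Fin (k + 1) :=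
  ⟨(Finset.univ.filter (Passed A t x τ)).card,
    Nat.lt_succ_of_le ((Finset.card_le_univ _).trans (Fintype.card_fin k).le)⟩

theorem castSucc_lt_slice (ht : StrictMono t) {x : V} {τ : ℝ} {i : Fin k} :
    i.castSucc < slice A t x τ ↔ Passed A t x τ i := by
  classical
  rw [Fin.lt_def]
  simp only [slice, Fin.val_castSucc]
  constructor
  · intro h
    by_contra hi
    refine absurd (Finset.card_le_card (t := Finset.Iio i) ?_) (by simpa using h)
    intro j hj
    simp only [Finset.mem_filter, Finset.mem_univ, true_and] at hj
    rw [Finset.mem_Iio]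
    by_contra hji
    exact hi (hj.of_le ht (not_lt.mp hji))
  · intro h
    have : Finset.Iic i ⊆ Finset.univ.filter (Passed A t x τ) := by
      intro j hj
      simpa using h.of_le ht (Finset.mem_Iic.mp hj)
    simpa [Nat.succ_le_iff] using Finset.card_le_card this

theorem slice_eq (ht : StrictMono t) {x : V} {τ : ℝ} {j : Fin (k + 1)}
    (h : ∀ i : Fin k, Passed A t x τ i ↔ i.castSucc < j) : slice A t x τ = j := by
  have key : ∀ i : Fin k, i.castSucc < slice A t x τ ↔ i.castSucc < j := fun i =>
    (castSucc_lt_slice ht).trans (h i)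
  rcases lt_trichotomy (slice A t x τ) j with hlt | heq | hlt
  · have := (key ⟨slice A t x τ, by omega⟩).2 hlt
    exact absurd this (by simp)
  · exact heq
  · have := (key ⟨j, by omega⟩).1 hlt
    exact absurd this (by simp)

/-- A choice of an instant strictly between any two successive bridges. -/
theorem exists_intermediate_times {β : ℝ} (hβ : 0 < β) (ht : t ∈ orderedTimes k β) :
    ∃ m : Fin (k + 1) → ℝ, ∀ j, 0 < m j ∧ m j < β ∧
      ∀ i : Fin k, (i.castSucc < j → t i < m j) ∧ (j ≤ i.castSucc → m j < t i) := by
  classical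
  obtain ⟨hm, hb⟩ := ht
  have : ∀ j : Fin (k + 1), ∃ m : ℝ, 0 < m ∧ m < β ∧
      ∀ i : Fin k, (i.castSucc < j → t i < m) ∧ (j ≤ i.castSucc → m < t i) := by
    intro j
    obtain ⟨m, h1, h2⟩ := Order.exists_between_finsets
      (insert 0 ((Finset.univ.filter fun i : Fin k => i.castSucc < j).image t))
      (insert β ((Finset.univ.filter fun i : Fin k => j ≤ i.castSucc).image t)) (by
        intro a ha b hb'
        simp only [Finset.mem_insert, Finset.mem_image, Finset.mem_filter, Finset.mem_univ,
          true_and] at ha hb'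
        rcases ha with rfl | ⟨i, hi, rfl⟩ <;> rcases hb' with rfl | ⟨i', hi', rfl⟩
        · exact hβ
        · exact (hb i').1
        · exact (hb i).2
        · exact hm (Fin.castSucc_lt_castSucc_iff.mp (hi.trans_le hi')))
    refine ⟨m, h1 0 (by simp), h2 β (by simp), fun i => ⟨fun hi => h1 _ ?_, fun hi => h2 _ ?_⟩⟩
    · exact Finset.mem_insert_of_mem (Finset.mem_image_of_mem _ (by simpa using hi))
    · exact Finset.mem_insert_of_mem (Finset.mem_image_of_mem _ (by simpa using hi))
  choose m hm' using this
  exact ⟨m, hm'⟩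

end Passage

/-! ### Paths of spin configurations -/

section Paths

variable {V : Type*} {G : SimpleGraph V} {k : ℕ}

/-- The pairs of spin configurations between which a bridge `e` has a nonzero matrix element: they
agree off `e`, and each has opposite spins at the two ends of `e`. -/
def Compatible (e : Sym2 V) (s s' : V → Fin 2) : Prop :=
  (∀ z, z ∉ e → s z = s' z) ∧ ∀ u v, e = s(u, v) → s u ≠ s v ∧ s' u ≠ s' v

/-- A sequence of spin configurations, periodic in time, with compatible jumps at the successive
bridges `e 0, …, e (k - 1)`. -/
def IsPath (e : Fin k → G.edgeSet) (p : Fin (k + 1) → V → Fin 2) : Prop :=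
  p 0 = p (Fin.last k) ∧ ∀ i : Fin k, Compatible (e i : Sym2 V) (p i.castSucc) (p i.succ)

/-- The spin at `x` does not change as long as no bridge ends at `x`. -/
theorem IsPath.apply_eq_of_le {e : Fin k → G.edgeSet} {p : Fin (k + 1) → V → Fin 2}
    (hp : IsPath e p) {x : V} {a b : Fin (k + 1)} (hab : a ≤ b)
    (h : ∀ i : Fin k, a ≤ i.castSucc → i.castSucc < b → x ∉ (e i : Sym2 V)) :
    p a x = p b x := by
  induction b using Fin.induction with
  | zero => rw [Fin.le_zero_iff.mp hab]
  | succ i ih =>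
    rcases hab.lt_or_eq with hlt | rfl
    · have hai : a ≤ i.castSucc := by rwa [Fin.le_castSucc_iff]
      rw [ih hai fun j h1 h2 => h j h1 (h2.trans i.castSucc_lt_succ)]
      exact (hp.2 i).1 x (h i hai i.castSucc_lt_succ)
    · rfl

theorem IsPath.apply_eq {e : Fin k → G.edgeSet} {p : Fin (k + 1) → V → Fin 2}
    (hp : IsPath e p) {x : V} {a b : Fin (k + 1)}
    (h : ∀ i : Fin k, x ∈ (e i : Sym2 V) → (i.castSucc < a ↔ i.castSucc < b)) :
    p a x = p b x := by
  rcases le_total a b with hab | hab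
  · exact hp.apply_eq_of_le hab fun i h1 h2 hx => absurd ((h i hx).2 h2) (not_lt.mpr h1)
  · exact (hp.apply_eq_of_le hab fun i h1 h2 hx => absurd ((h i hx).1 h2) (not_lt.mpr h1)).symm

open Classical in
/-- The involution of the spin values at `x` that exchanges them exactly when `x ∉ A`. -/
def stagger (A : Set V) (x : V) (a : Fin 2) : Fin 2 := if x ∈ A then a else 1 - a

@[simp]
theorem stagger_stagger (A : Set V) (x : V) (a : Fin 2) : stagger A x (stagger A x a) = a := by
  unfold stagger
  split_ifs <;> simp

/-- Opposite spins at the ends of a bond between the sublattices are equal staggered spins. -/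
theorem stagger_eq_iff_ne {A : Set V} {u v : V} (hu : u ∈ A) (hv : v ∉ A) {a b : Fin 2} :
    stagger A u a = stagger A v b ↔ a ≠ b := by
  simp only [stagger, hu, hv, if_true, if_false]
  revert a b
  decide

theorem stagger_ne {A : Set V} {u v : V} (hu : u ∈ A) (hv : v ∉ A) (a : Fin 2) :
    stagger A u a ≠ stagger A v a := by
  simp only [stagger, hu, hv, if_true, if_false]
  revert a
  decide

end Paths

/-! ### Spin assignments to loops are paths of spin configurations -/

section Correspondence

variable {V : Type*} {G : SimpleGraph V} {A : Set V} {k : ℕ} {β : ℝ}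
  {e : Fin k → G.edgeSet} {t : Fin k → ℝ}

theorem exists_edge_ends (hA : G.IsBipartiteWith A Aᶜ) (e : G.edgeSet) :
    ∃ u v, u ∈ A ∧ v ∉ A ∧ (e : Sym2 V) = s(u, v) := by
  obtain ⟨e, he⟩ := e
  induction e using Sym2.ind with
  | _ x y =>
    rcases hA.mem_of_adj he with ⟨hx, hy⟩ | ⟨hx, hy⟩
    · exact ⟨x, y, hx, hy, rfl⟩
    · exact ⟨y, x, hy, hx, Sym2.eq_swap⟩

theorem bridgeAt_iff {x : V} {r : ℝ} :
    BridgeAt (⟨k, e, t⟩ : BridgeConfig G) x r ↔ ∃ i, x ∈ (e i : Sym2 V) ∧ t i = r := by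
  simp only [BridgeAt, HasBridge, Sym2.mem_iff_exists]
  constructor
  · rintro ⟨y, i, h, hr⟩
    exact ⟨i, ⟨y, h⟩, hr⟩
  · rintro ⟨i, ⟨y, h⟩, hr⟩
    exact ⟨y, i, h, hr⟩

/-- The loop through the space-time point `(x, τ)`. -/
def loopThrough (A : Set V) (β : ℝ) (ω : BridgeConfig G) (x : V) (τ : ℝ) : Loops A β ω :=
  Quot.mk _ (x, (τ : AddCircle β))

theorem loopThrough_zero (ω : BridgeConfig G) (x : V) :
    loopThrough A β ω x 0 = loopAt A β ω x :=
  congrArg (Quot.mk _) (Prod.ext rfl (by simp))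

theorem loopThrough_period (ω : BridgeConfig G) (x : V) :
    loopThrough A β ω x β = loopAt A β ω x :=
  congrArg (Quot.mk _) (Prod.ext rfl (by simp))

/-- Two points over the same site lie on the same loop if no bridge ending there separates them. -/
theorem loopThrough_eq {x : V} {s s' : ℝ} (hs : 0 ≤ s) (hs' : s ≤ β) (hr : 0 ≤ s') (hr' : s' ≤ β)
    (h : ∀ i, x ∈ (e i : Sym2 V) → (Passed A t x s i ↔ Passed A t x s' i)) :
    loopThrough A β (⟨k, e, t⟩ : BridgeConfig G) x s = loopThrough A β ⟨k, e, t⟩ x s' := by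
  wlog hlt : s < s' generalizing s s'
  · rcases (not_lt.mp hlt).lt_or_eq with hlt | rfl
    · exact (this hr hr' hs hs' (fun i hi => (h i hi).symm) hlt).symm
    · rfl
  by_cases hx : x ∈ A
  · refine Quot.sound (Move.up hx hs hlt hr' fun r h1 h2 hb => ?_)
    obtain ⟨i, hi, rfl⟩ := bridgeAt_iff.mp hb
    have := (h i hi).2 (Or.inl h2)
    rcases this with h' | ⟨h', _⟩
    · linarith
    · exact h' hx
  · refine (Quot.sound (Move.down hx hs hlt hr' fun r h1 h2 hb => ?_)).symm
    obtain ⟨i, hi, rfl⟩ := bridgeAt_iff.mp hb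
    have := (h i hi).2 (h2.lt_or_eq.imp id fun h' => ⟨hx, h'⟩)
    rcases this with h' | ⟨_, h'⟩ <;> linarith

/-- The function on the cylinder described by a path of spin configurations: at `(x, τ)`, the
staggered spin at `x` in the time slice of `(x, τ)`. -/
def cylinderSpin (A : Set V) (t : Fin k → ℝ) (p : Fin (k + 1) → V → Fin 2) (x : V) (τ : ℝ) :
    Fin 2 :=
  stagger A x (p (slice A t x τ) x)

theorem slice_zero (ht : t ∈ orderedTimes k β) (x : V) : slice A t x 0 = 0 :=
  slice_eq ht.1 fun i => by
    have := (ht.2 i).1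
    simp only [Passed, Fin.not_lt_zero, iff_false, not_or]
    exact ⟨by linarith, fun h => by linarith [h.2]⟩

theorem slice_period (ht : t ∈ orderedTimes k β) (x : V) : slice A t x β = Fin.last k :=
  slice_eq ht.1 fun i => by simp [Passed, (ht.2 i).2, Fin.castSucc_lt_last]

/-- By periodicity of the path, the function on `[0, β)` gives the correct value at time `β`. -/
theorem cylinderSpin_liftIco [Fact (0 < β)] (ht : t ∈ orderedTimes k β)
    {p : Fin (k + 1) → V → Fin 2} (hp : IsPath e p) (x : V) {τ : ℝ} (h0 : 0 ≤ τ) (h1 : τ ≤ β) :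
    AddCircle.liftIco β 0 (cylinderSpin A t p x) (τ : AddCircle β) = cylinderSpin A t p x τ := by
  rcases h1.lt_or_eq with h1 | rfl
  · exact AddCircle.liftIco_coe_apply ⟨h0, by simpa using h1⟩
  · have : ((τ : ℝ) : AddCircle τ) = ((0 : ℝ) : AddCircle τ) := by simp
    rw [this, AddCircle.liftIco_coe_apply ⟨le_rfl, by simpa using Fact.out⟩]
    simp only [cylinderSpin, slice_zero ht, slice_period ht, hp.1]

theorem cylinderSpin_eq (ht : t ∈ orderedTimes k β) {p : Fin (k + 1) → V → Fin 2}
    (hp : IsPath e p) {x : V} {τ : ℝ} {j : Fin (k + 1)}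
    (h : ∀ i, x ∈ (e i : Sym2 V) → (Passed A t x τ i ↔ i.castSucc < j)) :
    cylinderSpin A t p x τ = stagger A x (p j x) := by
  unfold cylinderSpin
  rw [hp.apply_eq fun i hi => (castSucc_lt_slice ht.1).trans (h i hi)]

/-- The function on the cylinder given by a path of spin configurations is constant along
trajectories. -/
theorem cylinderSpin_move [Fact (0 < β)] (ht : t ∈ orderedTimes k β)
    {p : Fin (k + 1) → V → Fin 2} (hp : IsPath e p) {a b : V × AddCircle β}
    (hab : Move A (⟨k, e, t⟩ : BridgeConfig G) a b) :
    AddCircle.liftIco β 0 (cylinderSpin A t p a.1) a.2 =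
      AddCircle.liftIco β 0 (cylinderSpin A t p b.1) b.2 := by
  cases hab with
  | @up x s r hx h0 hst h1 hfree =>
    simp only
    rw [cylinderSpin_liftIco ht hp x h0 (by linarith),
      cylinderSpin_liftIco ht hp x (by linarith) h1]
    refine cylinderSpin_eq ht hp fun i hi => ?_
    rw [castSucc_lt_slice ht.1]
    simp only [Passed, hx, not_true, false_and, or_false]
    refine ⟨fun h => h.trans hst, fun h => ?_⟩
    by_contra h'
    exact hfree _ (not_lt.mp h') h (bridgeAt_iff.mpr ⟨i, hi, rfl⟩)
  | @down x s r hx h0 hst h1 hfree =>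
    simp only
    rw [cylinderSpin_liftIco ht hp x (by linarith) h1,
      cylinderSpin_liftIco ht hp x h0 (by linarith)]
    refine cylinderSpin_eq ht hp fun i hi => ?_
    rw [castSucc_lt_slice ht.1]
    simp only [Passed, hx, not_false_eq_true, true_and, ← le_iff_lt_or_eq]
    refine ⟨fun h => ?_, fun h => h.trans hst.le⟩
    by_contra h'
    exact hfree _ (not_le.mp h') h (bridgeAt_iff.mpr ⟨i, hi, rfl⟩)
  | @crossUp x y s r hx hy hb h0 hst h1 hfree =>
    simp only
    obtain ⟨i, hi, rfl⟩ := hb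
    simp only at hi hst h0 hfree ⊢
    rw [cylinderSpin_liftIco ht hp x h0 (by linarith),
      cylinderSpin_liftIco ht hp y (by linarith) h1,
      cylinderSpin_eq ht hp (j := i.succ), cylinderSpin_eq ht hp (j := i.succ)]
    · rw [eq_comm, stagger_eq_iff_ne hy hx]
      exact (((hp.2 i).2 x y hi).2).symm
    · intro i' hi'
      rw [Fin.castSucc_lt_succ_iff]
      simp only [Passed, hy, not_true, false_and, or_false]
      refine ⟨fun h => ?_, fun h => (ht.1.monotone h).trans_lt hst⟩
      by_contra h'
      exact hfree _ (ht.1 (not_le.mp h')) h (bridgeAt_iff.mpr ⟨i', hi', rfl⟩)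
    · intro i' hi'
      rw [Fin.castSucc_lt_succ_iff]
      simp only [Passed, hx, not_false_eq_true, true_and, ← le_iff_lt_or_eq, ht.1.le_iff_le]
  | @crossDown x y s r hx hy hb h0 hst h1 hfree =>
    simp only
    obtain ⟨i, hi, rfl⟩ := hb
    simp only at hi hst h1 hfree ⊢
    rw [cylinderSpin_liftIco ht hp x (by linarith) h1,
      cylinderSpin_liftIco ht hp y h0 (by linarith),
      cylinderSpin_eq ht hp (j := i.castSucc), cylinderSpin_eq ht hp (j := i.castSucc)]
    · rw [stagger_eq_iff_ne hx hy]
      exact ((hp.2 i).2 x y hi).1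
    · intro i' hi'
      rw [Fin.castSucc_lt_castSucc_iff]
      simp only [Passed, hy, not_false_eq_true, true_and, ← le_iff_lt_or_eq]
      refine ⟨fun h => ht.1.lt_iff_lt.mp (h.trans_lt hst), fun h => ?_⟩
      by_contra h'
      exact hfree _ (not_le.mp h') (ht.1 h) (bridgeAt_iff.mpr ⟨i', hi', rfl⟩)
    · intro i' hi'
      rw [Fin.castSucc_lt_castSucc_iff]
      simp only [Passed, hx, not_true, false_and, or_false, ht.1.lt_iff_lt]

/-- The spin configurations seen, at given times between the bridges, when all loops carry
constant staggered spins. -/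
def pathOfLoopSpins (m : Fin (k + 1) → ℝ) {ω : BridgeConfig G} (σ : Loops A β ω → Fin 2)
    (j : Fin (k + 1)) (x : V) : Fin 2 :=
  stagger A x (σ (loopThrough A β ω x (m j)))

/-- For ordered bridges, the spin assignments to the loops correspond to the periodic paths of
spin configurations that are compatible with the bridges. -/
theorem exists_loopSpins_equiv (hA : G.IsBipartiteWith A Aᶜ) (hβ : 0 < β)
    (ht : t ∈ orderedTimes k β) :
    ∃ Φ : (Loops A β (⟨k, e, t⟩ : BridgeConfig G) → Fin 2) ≃ {p // IsPath e p},
      ∀ σ x, (Φ σ).1 0 x = stagger A x (σ (loopAt A β ⟨k, e, t⟩ x)) := by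
  have : Fact (0 < β) := ⟨hβ⟩
  obtain ⟨m, hm⟩ := exists_intermediate_times hβ ht
  set ω : BridgeConfig G := ⟨k, e, t⟩
  have passed_m : ∀ x j i, Passed A t x (m j) i ↔ i.castSucc < j := by
    intro x j i
    constructor
    · intro h
      by_contra h'
      have := ((hm j).2.2 i).2 (not_lt.mp h')
      rcases h with h | ⟨_, h⟩ <;> linarith
    · exact fun h => Or.inl (((hm j).2.2 i).1 h)
  have slice_m : ∀ x j, slice A t x (m j) = j := fun x j => slice_eq ht.1 (passed_m x j)
  have hm0 : ∀ x, loopThrough A β ω x (m 0) = loopAt A β ω x := by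
    intro x
    rw [← loopThrough_zero]
    refine loopThrough_eq (hm 0).1.le (hm 0).2.1.le le_rfl hβ.le fun i _ => ?_
    rw [← castSucc_lt_slice ht.1, ← castSucc_lt_slice ht.1, slice_m, slice_zero ht]
  have hmk : ∀ x, loopThrough A β ω x (m (Fin.last k)) = loopAt A β ω x := by
    intro x
    rw [← loopThrough_period]
    refine loopThrough_eq (hm _).1.le (hm _).2.1.le hβ.le le_rfl fun i _ => ?_
    rw [← castSucc_lt_slice ht.1, ← castSucc_lt_slice ht.1, slice_m, slice_period ht]
  -- the trajectory that goes up at `u`, crosses the bridge and goes down at `v`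
  have below : ∀ (i : Fin k) (u v : V), u ∈ A → v ∉ A → (e i : Sym2 V) = s(u, v) →
      loopThrough A β ω u (m i.castSucc) = loopThrough A β ω v (m i.castSucc) := by
    intro i u v hu hv hi
    have hlt := ((hm i.castSucc).2.2 i).2 le_rfl
    trans loopThrough A β ω u (t i)
    · refine loopThrough_eq (hm _).1.le (hm _).2.1.le (ht.2 i).1.le (ht.2 i).2.le fun i' _ => ?_
      rw [passed_m, Fin.castSucc_lt_castSucc_iff]
      simp [Passed, hu, ht.1.lt_iff_lt]
    · refine Quot.sound (Move.crossDown hu hv ⟨i, hi, rfl⟩ (hm _).1.le hlt (ht.2 i).2.le ?_)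
      intro r h1 h2 hb
      obtain ⟨i', -, rfl⟩ := bridgeAt_iff.mp hb
      have h3 := ((hm i.castSucc).2.2 i').1
        (Fin.castSucc_lt_castSucc_iff.mpr (ht.1.lt_iff_lt.mp h2))
      linarith
  -- the trajectory that goes down at `v`, crosses the bridge and goes up at `u`
  have above : ∀ (i : Fin k) (u v : V), u ∈ A → v ∉ A → (e i : Sym2 V) = s(u, v) →
      loopThrough A β ω u (m i.succ) = loopThrough A β ω v (m i.succ) := by
    intro i u v hu hv hi
    have hlt := ((hm i.succ).2.2 i).1 i.castSucc_lt_succ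
    symm
    trans loopThrough A β ω v (t i)
    · refine loopThrough_eq (hm _).1.le (hm _).2.1.le (ht.2 i).1.le (ht.2 i).2.le fun i' _ => ?_
      rw [passed_m, Fin.castSucc_lt_succ_iff]
      simp [Passed, hv, ← le_iff_lt_or_eq, ht.1.le_iff_le]
    · refine Quot.sound (Move.crossUp hv hu ⟨i, hi.trans Sym2.eq_swap, rfl⟩ (ht.2 i).1.le hlt
        (hm _).2.1.le ?_)
      intro r h1 h2 hb
      obtain ⟨i', -, rfl⟩ := bridgeAt_iff.mp hb
      have h3 := ((hm i.succ).2.2 i').2 (Fin.succ_le_castSucc_iff.mpr (ht.1.lt_iff_lt.mp h1))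
      linarith
  have isPath : ∀ σ : Loops A β ω → Fin 2, IsPath e (pathOfLoopSpins m σ) := by
    intro σ
    refine ⟨?_, fun i => ⟨fun z hz => ?_, fun u v huv => ?_⟩⟩
    · funext x
      simp only [pathOfLoopSpins, hm0, hmk]
    · refine congrArg (fun γ => stagger A z (σ γ))
        (loopThrough_eq (hm _).1.le (hm _).2.1.le (hm _).1.le (hm _).2.1.le fun i' hi' => ?_)
      rw [passed_m, passed_m, Fin.castSucc_lt_castSucc_iff, Fin.castSucc_lt_succ_iff,
        le_iff_lt_or_eq, or_iff_left]
      rintro rfl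
      exact hz hi'
    · have key : ∀ u v : V, u ∈ A → v ∉ A → (e i : Sym2 V) = s(u, v) →
          pathOfLoopSpins m σ i.castSucc u ≠ pathOfLoopSpins m σ i.castSucc v ∧
          pathOfLoopSpins m σ i.succ u ≠ pathOfLoopSpins m σ i.succ v := by
        intro u v hu hv hi
        unfold pathOfLoopSpins
        rw [below i u v hu hv hi, above i u v hu hv hi]
        exact ⟨stagger_ne hu hv _, stagger_ne hu hv _⟩
      have hadj : G.Adj u v := by
        have := (e i).2
        rwa [huv] at this
      rcases hA.mem_of_adj hadj with ⟨hu, hv⟩ | ⟨hu, hv⟩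
      · exact key u v hu hv huv
      · have := key v u hv hu (huv.trans Sym2.eq_swap)
        exact ⟨this.1.symm, this.2.symm⟩
  -- conversely, the staggered spins of a path descend to the quotient by the trajectories
  have inv_eq : ∀ (p : {p // IsPath e p}) (x : V) (τ : ℝ), 0 ≤ τ → τ ≤ β →
      Quot.lift (r := Move A ω) (fun a : V × AddCircle β =>
        AddCircle.liftIco β 0 (cylinderSpin A t p.1 a.1) a.2)
        (fun _ _ hab => cylinderSpin_move ht p.2 hab) (loopThrough A β ω x τ) =
      cylinderSpin A t p.1 x τ := fun p x τ h0 h1 => cylinderSpin_liftIco ht p.2 x h0 h1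
  refine ⟨⟨fun σ => ⟨pathOfLoopSpins m σ, isPath σ⟩,
    fun p => Quot.lift (fun a => AddCircle.liftIco β 0 (cylinderSpin A t p.1 a.1) a.2)
      fun a b hab => cylinderSpin_move ht p.2 hab, fun σ => ?_, fun p => ?_⟩, fun σ x => ?_⟩
  · funext γ
    induction γ using Quot.ind with
    | mk a =>
      obtain ⟨x, τ⟩ := a
      obtain ⟨τ, hτ, rfl⟩ : ∃ r : ℝ, r ∈ Set.Ico (0 : ℝ) (0 + β) ∧ (r : AddCircle β) = τ :=
        ⟨AddCircle.equivIco β 0 τ, (AddCircle.equivIco β 0 τ).2, AddCircle.coe_equivIco⟩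
      rw [zero_add] at hτ
      refine (inv_eq ⟨_, isPath σ⟩ x τ hτ.1 hτ.2.le).trans ?_
      simp only [cylinderSpin, pathOfLoopSpins, stagger_stagger]
      congr 1
      refine loopThrough_eq (hm _).1.le (hm _).2.1.le hτ.1 hτ.2.le fun i _ => ?_
      rw [passed_m, castSucc_lt_slice ht.1]
  · apply Subtype.ext
    funext j x
    refine (congrArg (stagger A x) (inv_eq p x (m j) (hm j).1.le (hm j).2.1.le)).trans ?_
    rw [cylinderSpin, stagger_stagger, slice_m]
  · change stagger A x _ = _
    rw [hm0]

end Correspondence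

/-! ### Matrix products as sums over paths -/

section PathSum

/-- An entry of a product of matrices is a sum over the paths of indices. -/
theorem list_prod_ofFn_apply {ι R : Type*} [Fintype ι] [DecidableEq ι] [CommSemiring R] {k : ℕ}
    (N : Fin k → Matrix ι ι R) (a b : ι) :
    (List.ofFn N).prod a b =
      ∑ p : Fin (k + 1) → ι,
        if p 0 = a ∧ p (Fin.last k) = b then ∏ i : Fin k, N i (p i.castSucc) (p i.succ) else 0 := by
  induction k generalizing a with
  | zero =>
    rw [← (Equiv.funUnique (Fin 1) ι).symm.sum_comp]
    simp [Matrix.one_apply, ite_and]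
  | succ k ih =>
    rw [List.ofFn_succ, List.prod_cons, Matrix.mul_apply,
      ← (Fin.consEquiv fun _ => ι).sum_comp, Fintype.sum_prod_type]
    simp_rw [ih, Finset.mul_sum]
    rw [Finset.sum_comm, Finset.sum_comm (s := (Finset.univ : Finset ι))]
    refine Finset.sum_congr rfl fun p _ => ?_
    simp only [Fin.consEquiv_apply, Fin.cons_zero, ← Fin.succ_last, Fin.cons_succ,
      Fin.prod_univ_succ, Fin.castSucc_zero, ← Fin.succ_castSucc, ite_and]
    simp

/-- The noncommutative expansion of a power of a sum. -/
theorem sum_list_prod_ofFn {α R : Type*} [Fintype α] [Semiring R] (N : α → R) (k : ℕ) :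
    ∑ e : Fin k → α, (List.ofFn fun i => N (e i)).prod = (∑ a, N a) ^ k := by
  induction k with
  | zero => simp
  | succ k ih =>
    rw [← (Fin.consEquiv fun _ => α).sum_comp, Fintype.sum_prod_type, pow_succ', ← ih,
      Finset.sum_mul_sum]
    simp [List.ofFn_succ]

end PathSum

/-! ### Sums over the spins of the loops -/

section LoopSums

variable {V : Type*} {G : SimpleGraph V} {A : Set V} {k : ℕ} {β : ℝ}
  {e : Fin k → G.edgeSet} {t : Fin k → ℝ}

open Classical in
/-- The `0`-`1` matrix of `Compatible e`. The sublattice rotation, which changes the sign of basis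
vectors, takes it to twice the projection onto the singlet state of the bond `e`. -/
def bridgeMatrix (e : Sym2 V) : Matrix (V → Fin 2) (V → Fin 2) ℝ :=
  Matrix.of fun s s' => if Compatible e s s' then 1 else 0

/-- The trace of the product of the matrices of the bridges `e`, weighted by the function `F` of
the spin configuration at time `0`. -/
def bridgeTrace [Fintype V] [DecidableEq V] (F : (V → Fin 2) → ℝ) (e : Fin k → G.edgeSet) : ℝ :=
  ∑ s, F s * (List.ofFn fun i => bridgeMatrix (e i : Sym2 V)).prod s s

open Classical in
theorem bridgeTrace_eq_sum_paths [Fintype V] [DecidableEq V] (F : (V → Fin 2) → ℝ)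
    (e : Fin k → G.edgeSet) : bridgeTrace F e = ∑ p : {p // IsPath e p}, F (p.1 0) := by
  unfold bridgeTrace
  simp_rw [list_prod_ofFn_apply, Finset.mul_sum]
  rw [Finset.sum_comm, ← Finset.sum_subtype (Finset.univ.filter (IsPath e)) (by simp)
    fun p => F (p 0), Finset.sum_filter]
  refine Finset.sum_congr rfl fun p _ => ?_
  simp only [bridgeMatrix, Matrix.of_apply, Finset.prod_ite_zero, Finset.mem_univ, true_imp_iff,
    Finset.prod_const_one, ite_and, mul_ite, mul_one, mul_zero]
  rw [Finset.sum_ite_eq]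
  simp only [Finset.mem_univ, if_true, @eq_comm _ (p (Fin.last k)), IsPath]
  split_ifs <;> simp_all

/-- There are finitely many loops, since their spin assignments correspond to the finitely many
paths. -/
theorem finite_loops [Finite V] (hA : G.IsBipartiteWith A Aᶜ) (hβ : 0 < β)
    (ht : t ∈ orderedTimes k β) :
    Finite (Loops A β (⟨k, e, t⟩ : BridgeConfig G)) := by
  obtain ⟨Φ, -⟩ := exists_loopSpins_equiv (e := e) hA hβ ht
  have : Finite (Loops A β (⟨k, e, t⟩ : BridgeConfig G) → Fin 2) := Finite.of_equiv _ Φ.symm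
  classical
  -- the indicator functions of the loops are distinct spin assignments
  refine Finite.of_injective (fun γ => (Pi.single γ 1 : _ → Fin 2)) fun γ γ' h => ?_
  by_contra hne
  have := congrFun h γ
  simp [hne] at this

/-- The loop representation for a given sequence of bridges. -/
theorem sum_loopSpins [Fintype V] [DecidableEq V] (hA : G.IsBipartiteWith A Aᶜ) (hβ : 0 < β)
    (ht : t ∈ orderedTimes k β)
    [Fintype (Loops A β (⟨k, e, t⟩ : BridgeConfig G) → Fin 2)] (F : (V → Fin 2) → ℝ) :
    ∑ σ : Loops A β (⟨k, e, t⟩ : BridgeConfig G) → Fin 2,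
      F (fun x => stagger A x (σ (loopAt A β ⟨k, e, t⟩ x))) = bridgeTrace F e := by
  classical
  obtain ⟨Φ, hΦ⟩ := exists_loopSpins_equiv (e := e) hA hβ ht
  rw [bridgeTrace_eq_sum_paths, ← Φ.sum_comp]
  refine Finset.sum_congr rfl fun σ _ => congrArg F ?_
  funext x
  exact (hΦ σ x).symm

/-- The sign of a spin: `1` for spin `1/2`, which is labelled `0`, and `-1` for spin `-1/2`. -/
def spinSign (a : Fin 2) : ℝ := if a = 0 then 1 else -1

@[simp]
theorem spinSign_zero : spinSign 0 = 1 := rfl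

@[simp]
theorem spinSign_one : spinSign 1 = -1 := rfl

theorem spinSign_mul_self (a : Fin 2) : spinSign a * spinSign a = 1 := by
  unfold spinSign
  split_ifs <;> norm_num

theorem sgn_mul_self (A : Set V) (x : V) : (sgn A x : ℝ) * sgn A x = 1 := by
  unfold sgn
  split_ifs <;> norm_num

theorem spinSign_stagger (A : Set V) (x : V) (a : Fin 2) :
    spinSign (stagger A x a) = sgn A x * spinSign a := by
  unfold stagger sgn
  split_ifs
  · simp
  · fin_cases a <;> simp [spinSign]

/-- Independent spins in fields `c γ`: each sum over a spin gives `2 cosh (c γ)`, or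
`2 sinh (c γ) = tanh (c γ) * 2 cosh (c γ)` where the spin is inserted. -/
theorem sum_prod_spinSign_mul_exp {Γ : Type*} [Fintype Γ] [DecidableEq Γ] (c : Γ → ℝ)
    (S : Finset Γ) :
    ∑ σ : Γ → Fin 2, (∏ γ ∈ S, spinSign (σ γ)) * Real.exp (∑ γ, c γ * spinSign (σ γ)) =
      (∏ γ ∈ S, Real.tanh (c γ)) * ∏ γ, 2 * Real.cosh (c γ) := by
  have h1 : ∀ σ : Γ → Fin 2, (∏ γ ∈ S, spinSign (σ γ)) * Real.exp (∑ γ, c γ * spinSign (σ γ)) =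
      ∏ γ, (if γ ∈ S then spinSign (σ γ) else 1) * Real.exp (c γ * spinSign (σ γ)) := by
    intro σ
    rw [Finset.prod_mul_distrib, Real.exp_sum, Finset.prod_ite_mem, Finset.univ_inter]
  simp_rw [h1]
  rw [← Fintype.prod_sum
    (fun γ (a : Fin 2) => (if γ ∈ S then spinSign a else 1) * Real.exp (c γ * spinSign a)),
    ← Finset.univ_inter S, ← Finset.prod_ite_mem, ← Finset.prod_mul_distrib]
  refine Finset.prod_congr rfl fun γ _ => ?_
  rw [Fin.sum_univ_two]
  simp only [spinSign_zero, spinSign_one, Finset.univ_inter]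
  split_ifs
  · rw [Real.tanh_eq_sinh_div_cosh, ← mul_assoc, mul_comm _ 2, mul_assoc,
      div_mul_cancel₀ _ (Real.cosh_pos _).ne', Real.sinh_eq]
    simp only [mul_one, mul_neg]
    ring
  · rw [Real.cosh_eq]
    simp only [mul_one, mul_neg]
    ring

/-- The weight `exp (2 β h S)` of a spin configuration with total third spin component `S`. -/
def fieldWeight [Fintype V] (β h : ℝ) (s : V → Fin 2) : ℝ :=
  Real.exp (β * h * ∑ x, spinSign (s x))

/-- The loop `γ` contributes its staggered spin, times its winding number, to the total third spin
component at time `0`. -/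
theorem fieldWeight_stagger [Fintype V] {ω : BridgeConfig G} [Fintype (Loops A β ω)] (h : ℝ)
    (σ : Loops A β ω → Fin 2) :
    fieldWeight β h (fun x => stagger A x (σ (loopAt A β ω x))) =
      Real.exp (∑ γ, β * h * winding A β ω γ * spinSign (σ γ)) := by
  classical
  unfold fieldWeight
  simp_rw [spinSign_stagger, mul_assoc, ← Finset.mul_sum, winding, Int.cast_sum, Finset.sum_mul]
  rw [Finset.sum_comm]
  simp

theorem loopWeight_eq_prod [Fintype V] {ω : BridgeConfig G} [Fintype (Loops A β ω)] (h : ℝ) :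
    loopWeight A β h ω = ∏ γ, 2 * Real.cosh (β * h * winding A β ω γ) :=
  finprod_eq_prod_of_fintype _

theorem loopWeight_eq [Fintype V] [DecidableEq V] (hA : G.IsBipartiteWith A Aᶜ) (hβ : 0 < β) (h : ℝ)
    (ht : t ∈ orderedTimes k β) :
    loopWeight A β h (⟨k, e, t⟩ : BridgeConfig G) = bridgeTrace (fieldWeight β h) e := by
  classical
  have := finite_loops (e := e) hA hβ ht
  have := Fintype.ofFinite (Loops A β (⟨k, e, t⟩ : BridgeConfig G))
  rw [← sum_loopSpins hA hβ ht, loopWeight_eq_prod]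
  simp_rw [fieldWeight_stagger]
  simpa using (sum_prod_spinSign_mul_exp _ ∅).symm

theorem tanhAt_mul_loopWeight_eq [Fintype V] [DecidableEq V] (hA : G.IsBipartiteWith A Aᶜ)
    (hβ : 0 < β) (h : ℝ) (ht : t ∈ orderedTimes k β) (x : V) :
    tanhAt A β h (⟨k, e, t⟩ : BridgeConfig G) x * loopWeight A β h ⟨k, e, t⟩ =
      bridgeTrace (fun s => sgn A x * spinSign (s x) * fieldWeight β h s) e := by
  classical
  have := finite_loops (e := e) hA hβ ht
  have := Fintype.ofFinite (Loops A β (⟨k, e, t⟩ : BridgeConfig G))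
  rw [← sum_loopSpins hA hβ ht, loopWeight_eq_prod]
  simp_rw [fieldWeight_stagger, spinSign_stagger, ← mul_assoc, sgn_mul_self, one_mul]
  simpa [tanhAt] using (sum_prod_spinSign_mul_exp
    (fun γ => β * h * winding A β (⟨k, e, t⟩ : BridgeConfig G) γ) {loopAt A β ⟨k, e, t⟩ x}).symm

theorem loopWeight_mul_pairFactor_eq [Fintype V] [DecidableEq V] (hA : G.IsBipartiteWith A Aᶜ)
    (hβ : 0 < β) (h : ℝ) (ht : t ∈ orderedTimes k β) (x y : V) :
    loopWeight A β h (⟨k, e, t⟩ : BridgeConfig G) * pairFactor A β h ⟨k, e, t⟩ x y =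
      bridgeTrace (fun s => sgn A x * sgn A y * (spinSign (s x) * spinSign (s y)) *
        fieldWeight β h s) e := by
  classical
  have := finite_loops (e := e) hA hβ ht
  have := Fintype.ofFinite (Loops A β (⟨k, e, t⟩ : BridgeConfig G))
  rw [← sum_loopSpins hA hβ ht, loopWeight_eq_prod]
  have key : ∀ a b : ℝ, (sgn A x : ℝ) * sgn A y * (sgn A x * a * (sgn A y * b)) = a * b := by
    intro a b
    linear_combination (sgn A y * sgn A y * a * b : ℝ) * sgn_mul_self A x +
      a * b * sgn_mul_self A y
  simp_rw [fieldWeight_stagger, spinSign_stagger, key]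
  unfold pairFactor
  split_ifs with hxy
  · simp_rw [hxy, spinSign_mul_self]
    simpa using (sum_prod_spinSign_mul_exp _ ∅).symm
  · have := (sum_prod_spinSign_mul_exp
      (fun γ => β * h * winding A β (⟨k, e, t⟩ : BridgeConfig G) γ)
      {loopAt A β ⟨k, e, t⟩ x, loopAt A β ⟨k, e, t⟩ y}).symm
    simp_rw [Finset.prod_pair hxy] at this
    rw [mul_comm]
    exact this

end LoopSums

/-! ### Integration against the Poisson edge process -/

section Poisson

variable {V : Type*} {G : SimpleGraph V} {β : ℝ}

theorem measurableSet_sigma_iff {ι : Type*} {α : ι → Type*} [∀ i, MeasurableSpace (α i)]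
    {S : Set (Σ i, α i)} : MeasurableSet S ↔ ∀ i, MeasurableSet (Sigma.mk i ⁻¹' S) := by
  rw [Sigma.instMeasurableSpace, MeasurableSpace.measurableSet_iInf]
  rfl

theorem measurable_mk (k : ℕ) :
    Measurable fun q : (Fin k → G.edgeSet) × (Fin k → ℝ) => (⟨k, q⟩ : BridgeConfig G) :=
  fun _ hS => measurableSet_sigma_iff.mp hS k

theorem isOpen_orderedTimes (k : ℕ) (β : ℝ) : IsOpen (orderedTimes k β) := by
  have : orderedTimes k β = (⋂ i, ⋂ j, ⋂ _ : i < j, {t : Fin k → ℝ | t i < t j}) ∩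
      ⋂ i, ({t : Fin k → ℝ | 0 < t i} ∩ {t | t i < β}) := by
    ext t
    simp [orderedTimes, StrictMono]
  rw [this]
  refine IsOpen.inter ?_ ?_
  · refine isOpen_iInter_of_finite fun i => isOpen_iInter_of_finite fun j =>
      isOpen_iInter_of_finite fun _ => isOpen_lt (continuous_apply i) (continuous_apply j)
  · exact isOpen_iInter_of_finite fun i =>
      (isOpen_lt continuous_const (continuous_apply i)).inter
        (isOpen_lt (continuous_apply i) continuous_const)

theorem orderedTimes_nonempty (k : ℕ) (hβ : 0 < β) : (orderedTimes k β).Nonempty := by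
  refine ⟨fun i => β * ((i + 1) / (k + 1)), fun i j hij => ?_, fun i => ⟨by positivity, ?_⟩⟩
  · have : (i : ℝ) < j := by exact_mod_cast hij
    simp only
    gcongr
  · have : (i : ℝ) < k := by exact_mod_cast i.2
    have : ((i : ℝ) + 1) / (k + 1) < 1 := by
      rw [div_lt_one (by positivity)]
      linarith
    nlinarith

theorem isProbabilityMeasure_cond_orderedTimes (k : ℕ) (hβ : 0 < β) :
    IsProbabilityMeasure (volume[|orderedTimes k β]) := by
  refine cond_isProbabilityMeasure_of_finite ?_ ?_
  · exact ((isOpen_orderedTimes k β).measure_pos _ (orderedTimes_nonempty k hβ)).ne'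
  · refine ne_top_of_le_ne_top (b := volume (Set.Icc (0 : Fin k → ℝ) fun _ => β))
      isCompact_Icc.measure_ne_top (measure_mono fun t ht => ?_)
    exact ⟨fun i => (ht.2 i).1.le, fun i => (ht.2 i).2.le⟩

instance {α : Type*} [MeasurableSpace α] (S : Set α) : IsFiniteMeasure (uniformOn S) := by
  unfold uniformOn
  infer_instance

variable [Fintype V] [DecidableRel G.Adj]

instance : SFinite (poissonEdgeMeasure G β) := by
  unfold poissonEdgeMeasure
  infer_instance

theorem card_edgeSet : Fintype.card G.edgeSet = G.edgeFinset.card := by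
  rw [SimpleGraph.edgeFinset_card]

theorem integral_uniformOn_univ {α : Type*} [Fintype α] [MeasurableSpace α]
    [DiscreteMeasurableSpace α] (f : α → ℝ) :
    ∫ a, f a ∂(uniformOn Set.univ) = (Fintype.card α : ℝ)⁻¹ * ∑ a, f a := by
  rw [integral_fintype Integrable.of_finite, Finset.mul_sum]
  refine Finset.sum_congr rfl fun a _ => ?_
  rw [measureReal_def, uniformOn_univ]
  simp

/-- Almost every realization of the Poisson edge process consists of ordered bridges. -/
theorem ae_orderedTimes (G : SimpleGraph V) [DecidableRel G.Adj] (β : ℝ) :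
    ∀ᵐ ω ∂(poissonEdgeMeasure G β), ω.2.2 ∈ orderedTimes ω.1 β := by
  unfold poissonEdgeMeasure
  rw [Measure.ae_sum_iff]
  intro k
  refine Measure.ae_smul_measure ?_ _
  rw [ae_map_iff (measurable_mk k).aemeasurable]
  · exact Measure.quasiMeasurePreserving_snd.ae
      (ae_cond_mem (isOpen_orderedTimes k β).measurableSet)
  · exact measurableSet_sigma_iff.mpr fun k =>
      measurable_snd (isOpen_orderedTimes k β).measurableSet

/-- The contribution to the integral of the realizations with `k` bridges. -/
theorem integral_poissonEdgeMeasure_component (hβ : 0 < β) (k : ℕ)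
    (g : (k : ℕ) → (Fin k → G.edgeSet) → ℝ) :
    Integrable (fun ω : BridgeConfig G => g ω.1 ω.2.1)
      (poissonMeasure (β * G.edgeFinset.card).toNNReal {k} •
        ((uniformOn (Set.univ : Set (Fin k → G.edgeSet))).prod
          (volume[|orderedTimes k β])).map (Sigma.mk k)) ∧
    ∫ ω : BridgeConfig G, g ω.1 ω.2.1
      ∂(poissonMeasure (β * G.edgeFinset.card).toNNReal {k} •
        ((uniformOn (Set.univ : Set (Fin k → G.edgeSet))).prod
          (volume[|orderedTimes k β])).map (Sigma.mk k)) =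
      Real.exp (-(β * G.edgeFinset.card)) * (β ^ k / k.factorial * ∑ e, g k e) := by
  have := isProbabilityMeasure_cond_orderedTimes k hβ
  have hmeas : Measurable fun ω : BridgeConfig G => g ω.1 ω.2.1 := fun S hS =>
    measurableSet_sigma_iff.mpr fun k =>
      ((Measurable.of_discrete (f := g k)).comp measurable_fst) hS
  have hfin : poissonMeasure (β * G.edgeFinset.card).toNNReal {k} ≠ ∞ := measure_ne_top _ _
  constructor
  · refine Integrable.smul_measure ?_ hfin
    rw [integrable_map_measure hmeas.aestronglyMeasurable (measurable_mk k).aemeasurable]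
    exact (Integrable.of_finite (f := g k)).comp_fst _
  · rw [integral_smul_measure, integral_map (measurable_mk k).aemeasurable
      hmeas.aestronglyMeasurable]
    dsimp only
    rw [integral_fun_fst, integral_uniformOn_univ, poissonMeasure_singleton,
      ENNReal.toReal_ofReal (by positivity), Real.coe_toNNReal _ (by positivity), Fintype.card_fun,
      card_edgeSet, Fintype.card_fin]
    simp only [probReal_univ, smul_eq_mul]
    push_cast
    rcases Nat.eq_zero_or_pos G.edgeFinset.card with h0 | hpos
    · -- without edges, the sum over the edges is empty unless `k = 0`
      rcases Nat.eq_zero_or_pos k with rfl | hk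
      · simp
      · have : IsEmpty G.edgeSet := by
          rw [← Fintype.card_eq_zero_iff, card_edgeSet, h0]
        have : IsEmpty (Fin k → G.edgeSet) := ⟨fun e => this.false (e ⟨0, hk⟩)⟩
        simp
    · have : (G.edgeFinset.card : ℝ) ≠ 0 := by exact_mod_cast hpos.ne'
      rw [mul_pow]
      field_simp

/-- A function of the bridges that, for ordered bridges, depends only on the sequence of the edges
is integrated by summing over these sequences. -/
theorem hasSum_integral_poissonEdgeMeasure (hβ : 0 < β) {f : BridgeConfig G → ℝ}
    {g : (k : ℕ) → (Fin k → G.edgeSet) → ℝ}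
    (hfg : ∀ k e t, t ∈ orderedTimes k β → f ⟨k, e, t⟩ = g k e)
    (hg : Summable fun k => β ^ k / k.factorial * ∑ e, |g k e|) :
    Integrable f (poissonEdgeMeasure G β) ∧
      HasSum (fun k => Real.exp (-(β * G.edgeFinset.card)) * (β ^ k / k.factorial * ∑ e, g k e))
        (∫ ω, f ω ∂(poissonEdgeMeasure G β)) := by
  have hae : f =ᵐ[poissonEdgeMeasure G β] fun ω => g ω.1 ω.2.1 := by
    filter_upwards [ae_orderedTimes G β] with ω hω
    exact hfg ω.1 ω.2.1 ω.2.2 hω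
  have hint : Integrable (fun ω : BridgeConfig G => g ω.1 ω.2.1) (poissonEdgeMeasure G β) := by
    refine integrable_sum_measure (fun k => (integral_poissonEdgeMeasure_component hβ k g).1) ?_
    simp_rw [Real.norm_eq_abs,
      fun k => (integral_poissonEdgeMeasure_component hβ k fun k e => |g k e|).2]
    exact hg.mul_left _
  refine ⟨hint.congr hae.symm, ?_⟩
  rw [integral_congr_ae hae]
  simp_rw [← fun k => (integral_poissonEdgeMeasure_component hβ k g).2]
  exact hasSum_integral_measure hint

end Poisson

/-! ### The Hamiltonian after a sublattice rotation -/

section Hamiltonian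

variable {V : Type*} {G : SimpleGraph V} {A : Set V}

theorem siteOp_diagonal [Fintype V] [DecidableEq V] (x : V) (d : Fin 2 → ℂ) :
    siteOp x (Matrix.diagonal d) = Matrix.diagonal fun s => d (s x) := by
  ext s s'
  simp only [siteOp, tensorOp, Matrix.of_apply, Matrix.diagonal_apply]
  split_ifs with h
  · subst h
    rw [Finset.prod_eq_single x]
    · simp
    · intro z _ hz
      simp [Function.update_of_ne hz]
    · simp
  · obtain ⟨z, hz⟩ := Function.ne_iff.mp h
    refine Finset.prod_eq_zero (Finset.mem_univ z) ?_
    by_cases hzx : z = x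
    · subst hzx
      simp [hz]
    · simp [Function.update_of_ne hzx, hz]

theorem spin₃_eq [Fintype V] [DecidableEq V] (x : V) :
    spin₃ x = Matrix.diagonal fun s : V → Fin 2 => (1 / 2 : ℂ) * spinSign (s x) := by
  have : pauli 2 = Matrix.diagonal fun a : Fin 2 => (1 / 2 : ℂ) * spinSign a := by
    ext a b
    fin_cases a <;> fin_cases b <;> simp [pauli]
  rw [spin₃, spin, this, siteOp_diagonal]

theorem spin_mul_spin_apply [Fintype V] [DecidableEq V] {x y : V} (hxy : x ≠ y)
    (i : Fin 3) (s s' : V → Fin 2) :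
    (spin i x * spin i y) s s' =
      if ∀ z, z ≠ x → z ≠ y → s z = s' z then
        pauli i (s x) (s' x) * pauli i (s y) (s' y) else 0 := by
  simp only [spin, siteOp, tensorOp_mul]
  simp only [tensorOp, Matrix.of_apply]
  split_ifs with h
  · rw [← Finset.prod_subset (Finset.subset_univ {x, y}), Finset.prod_pair hxy]
    · simp [Function.update_of_ne hxy, Function.update_of_ne hxy.symm]
    · intro z _ hz
      simp only [Finset.mem_insert, Finset.mem_singleton, not_or] at hz
      simp [Function.update_of_ne hz.1, Function.update_of_ne hz.2, h z hz.1 hz.2]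
  · push Not at h
    obtain ⟨z, hx, hy, hz⟩ := h
    refine Finset.prod_eq_zero (Finset.mem_univ z) ?_
    simp [Function.update_of_ne hx, Function.update_of_ne hy, hz]

open Classical in
/-- The sign `∏ (-1)` over the sites outside `A` with spin `-1/2`, which implements the rotation by
`π` about the third spin axis on the complement of `A`. -/
def rotationSign [Fintype V] (A : Set V) (s : V → Fin 2) : ℝ :=
  ∏ z, if z ∈ A then 1 else spinSign (s z)

theorem rotationSign_mul_self [Fintype V] (A : Set V) (s : V → Fin 2) :
    rotationSign A s * rotationSign A s = 1 := by
  unfold rotationSign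
  rw [← Finset.prod_mul_distrib]
  refine Finset.prod_eq_one fun z _ => ?_
  split_ifs <;> simp [spinSign_mul_self]

theorem rotationSign_mul [Fintype V] {u v : V} (hu : u ∈ A) (hv : v ∉ A) {s s' : V → Fin 2}
    (h : ∀ z, z ≠ u → z ≠ v → s z = s' z) :
    rotationSign A s * rotationSign A s' = spinSign (s v) * spinSign (s' v) := by
  unfold rotationSign
  rw [← Finset.prod_mul_distrib, Finset.prod_eq_single v]
  · simp [hv]
  · intro z _ hz
    split_ifs with hzA
    · simp
    · rw [h z (fun h => hzA (h ▸ hu)) hz, spinSign_mul_self]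
  · simp

theorem compatible_mk_iff {u v : V} {s s' : V → Fin 2} :
    Compatible s(u, v) s s' ↔ (∀ z, z ≠ u → z ≠ v → s z = s' z) ∧ s u ≠ s v ∧ s' u ≠ s' v := by
  simp only [Compatible, Sym2.mem_iff, not_or, and_imp]
  refine and_congr_right fun _ => ⟨fun h => h u v rfl, fun h a b hab => ?_⟩
  rcases Sym2.eq_iff.mp hab with ⟨rfl, rfl⟩ | ⟨rfl, rfl⟩
  · exact h
  · exact ⟨h.1.symm, h.2.symm⟩

/-- Up to a constant, `-2 S_u · S_v` is conjugate, by the sublattice rotation, to the nonnegative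
matrix of the bridge. -/
theorem bondOp_apply [Fintype V] [DecidableEq V] (hA : G.IsBipartiteWith A Aᶜ)
    (e : G.edgeSet) (s s' : V → Fin 2) :
    bondOp (e : Sym2 V) s s' = (1 / 4 : ℂ) * (1 : Matrix (V → Fin 2) (V → Fin 2) ℂ) s s' -
      1 / 2 * (rotationSign A s * bridgeMatrix (e : Sym2 V) s s' * rotationSign A s' : ℝ) := by
  classical
  obtain ⟨u, v, hu, hv, he⟩ := exists_edge_ends hA e
  have huv : u ≠ v := fun h => hv (h ▸ hu)
  rw [he]
  change spinDot u v s s' = _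
  rw [spinDot, Matrix.sum_apply]
  simp_rw [spin_mul_spin_apply huv]
  rw [mul_right_comm]
  by_cases h : ∀ z, z ≠ u → z ≠ v → s z = s' z
  · rw [rotationSign_mul hu hv h]
    have h1 : (1 : Matrix (V → Fin 2) (V → Fin 2) ℂ) s s' =
        if s u = s' u ∧ s v = s' v then 1 else 0 := by
      rw [Matrix.one_apply]
      refine if_congr ⟨fun h => h ▸ ⟨rfl, rfl⟩, fun h' => funext fun z => ?_⟩ rfl rfl
      by_cases hzu : z = u
      · exact hzu ▸ h'.1
      by_cases hzv : z = v
      · exact hzv ▸ h'.2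
      exact h z hzu hzv
    have h2 : bridgeMatrix s(u, v) s s' = if s u ≠ s v ∧ s' u ≠ s' v then 1 else 0 := by
      simp only [bridgeMatrix, Matrix.of_apply, compatible_mk_iff]
      exact if_congr (and_iff_right h) rfl rfl
    rw [h1, h2]
    simp only [if_pos h]
    -- both sides depend only on the four spins at the ends of the bond
    generalize s u = a, s v = b, s' u = a', s' v = b'
    rw [Fin.sum_univ_three]
    fin_cases a <;> fin_cases b <;> fin_cases a' <;> fin_cases b' <;>
      (simp [pauli]; try ring_nf; try simp; try norm_num)
  · have h1 : (1 : Matrix (V → Fin 2) (V → Fin 2) ℂ) s s' = 0 :=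
      Matrix.one_apply_ne fun h' => h fun z _ _ => congrFun h' z
    have h2 : bridgeMatrix s(u, v) s s' = 0 := by
      simp only [bridgeMatrix, Matrix.of_apply, compatible_mk_iff]
      exact if_neg fun h' => h h'.1
    simp [h, h1, h2]

/-- The sum of the matrices of the bridges. -/
def bridgeSum [Fintype V] (G : SimpleGraph V) [DecidableRel G.Adj] :
    Matrix (V → Fin 2) (V → Fin 2) ℝ :=
  ∑ e : G.edgeSet, bridgeMatrix (e : Sym2 V)

/-- After the sublattice rotation, the exponent of the Gibbs operator at inverse temperature `2 β`
is the sum of a nonnegative matrix and of a function of the total third spin component. -/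
theorem neg_smul_hamiltonian [Fintype V] [DecidableEq V] [DecidableRel G.Adj]
    (hA : G.IsBipartiteWith A Aᶜ) (β h : ℝ) :
    -((2 * β : ℝ) : ℂ) • hamiltonian G h =
      (Matrix.diagonal fun s => (rotationSign A s : ℂ)) *
        ((β • bridgeSum G).map Complex.ofReal +
          Matrix.diagonal fun s : V → Fin 2 =>
            (((β * h * ∑ x, spinSign (s x)) - β / 2 * G.edgeFinset.card : ℝ) : ℂ)) *
        (Matrix.diagonal fun s => (rotationSign A s : ℂ)) := by
  have hsum : ∑ e ∈ G.edgeFinset, bondOp e = ∑ e : G.edgeSet, bondOp (e : Sym2 V) :=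
    Finset.sum_subtype _ (by simp) _
  have hcard : (G.edgeFinset.card : ℂ) = ∑ e : G.edgeSet, 1 := by
    rw [Finset.sum_const, Finset.card_univ, SimpleGraph.edgeFinset_card, nsmul_one]
  ext s s'
  rw [Matrix.mul_diagonal, Matrix.diagonal_mul, hamiltonian, hsum]
  simp only [Matrix.smul_apply, Matrix.sub_apply, Matrix.sum_apply, bondOp_apply hA,
    Matrix.add_apply, Matrix.map_apply, bridgeSum, spin₃_eq, smul_eq_mul]
  by_cases hs : s = s'
  · subst hs
    have hr : (rotationSign A s : ℂ) * rotationSign A s = 1 := by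
      exact_mod_cast rotationSign_mul_self A s
    simp only [Matrix.one_apply_eq, Matrix.diagonal_apply_eq]
    push_cast
    rw [hcard, Finset.sum_sub_distrib]
    simp only [← Finset.mul_sum, ← Finset.sum_mul]
    linear_combination (-(β * h * ∑ x, (spinSign (s x) : ℂ)) + β / 2 * ∑ e : G.edgeSet, 1) * hr
  · simp only [Matrix.one_apply_ne hs, Matrix.diagonal_apply_ne _ hs]
    push_cast
    simp only [← Finset.mul_sum, ← Finset.sum_mul, mul_zero, zero_sub, Finset.sum_neg_distrib,
      Finset.sum_const_zero]
    ring

theorem sum_spinSign_eq_of_compatible [Fintype V] {e : Sym2 V} (he : e ∈ G.edgeSet)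
    {s s' : V → Fin 2} (h : Compatible e s s') : ∑ x, spinSign (s x) = ∑ x, spinSign (s' x) := by
  induction e using Sym2.ind with
  | _ u v =>
    have huv : u ≠ v := G.ne_of_adj he
    obtain ⟨h1, h2, h3⟩ := compatible_mk_iff.mp h
    classical
    rw [← sub_eq_zero, ← Finset.sum_sub_distrib,
      ← Finset.sum_subset (Finset.subset_univ {u, v}), Finset.sum_pair huv]
    · have key : ∀ a b : Fin 2, a ≠ b → spinSign a + spinSign b = 0 := by
        intro a b hab
        fin_cases a <;> fin_cases b <;> simp_all
      linear_combination key _ _ h2 - key _ _ h3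
    · intro z _ hz
      simp only [Finset.mem_insert, Finset.mem_singleton, not_or] at hz
      rw [h1 z hz.1 hz.2, sub_self]

/-- The bridges conserve the total third spin component. -/
theorem commute_bridgeSum_diagonal [Fintype V] [DecidableEq V] [DecidableRel G.Adj] (f : ℝ → ℝ) :
    Commute (bridgeSum G) (Matrix.diagonal fun s : V → Fin 2 => f (∑ x, spinSign (s x))) := by
  refine Commute.sum_left _ _ _ fun e _ => ?_
  ext s s'
  rw [Matrix.mul_diagonal, Matrix.diagonal_mul, mul_comm]
  by_cases h : Compatible (e : Sym2 V) s s'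
  · rw [sum_spinSign_eq_of_compatible e.2 h]
  · simp [bridgeMatrix, h]

theorem exp_map_ofReal {n : Type*} [Fintype n] [DecidableEq n] (N : Matrix n n ℝ) :
    NormedSpace.exp (N.map Complex.ofReal) = (NormedSpace.exp N).map Complex.ofReal := by
  open scoped Matrix.Norms.Operator in
  exact (NormedSpace.map_exp (Complex.ofRealHom.mapMatrix (m := n))
    (by exact continuous_id.matrix_map Complex.continuous_ofReal) N).symm

/-- Traces against the Gibbs operator of observables that are diagonal in the basis of spin
configurations. -/
theorem trace_diagonal_mul_gibbsOp [Fintype V] [DecidableEq V] [DecidableRel G.Adj]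
    (hA : G.IsBipartiteWith A Aᶜ) (β h : ℝ) (o : (V → Fin 2) → ℝ) :
    (Matrix.diagonal (fun s => (o s : ℂ)) * gibbsOp G (2 * β) h).trace =
      ((Real.exp (-(β / 2 * G.edgeFinset.card)) *
        ∑ s, o s * fieldWeight β h s * NormedSpace.exp (β • bridgeSum G) s s : ℝ) : ℂ) := by
  set U : Matrix (V → Fin 2) (V → Fin 2) ℂ :=
    Matrix.diagonal fun s => (rotationSign A s : ℂ)
  have hU : U * U = 1 := by
    rw [Matrix.diagonal_mul_diagonal, ← Matrix.diagonal_one]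
    congr 1
    funext s
    exact_mod_cast rotationSign_mul_self A s
  have hinv : U⁻¹ = U := Matrix.inv_eq_right_inv hU
  have hunit : IsUnit U := ⟨⟨U, U, hU, hU⟩, rfl⟩
  set d : (V → Fin 2) → ℝ :=
    fun s => β * h * ∑ x, spinSign (s x) - β / 2 * G.edgeFinset.card
  have hcomm : Commute (β • bridgeSum G) (Matrix.diagonal d) :=
    (commute_bridgeSum_diagonal fun m => β * h * m - β / 2 * G.edgeFinset.card).smul_left β
  have hd : (Matrix.diagonal fun s => (d s : ℂ)) = (Matrix.diagonal d).map Complex.ofReal := by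
    rw [Matrix.diagonal_map Complex.ofReal_zero]
  have hexp : gibbsOp G (2 * β) h =
      U * (NormedSpace.exp (β • bridgeSum G) * Matrix.diagonal fun s => Real.exp (d s)).map
        Complex.ofReal * U := by
    have h1 : -((2 * β : ℝ) : ℂ) • hamiltonian G h =
        U * ((β • bridgeSum G).map Complex.ofReal + Matrix.diagonal fun s => (d s : ℂ)) * U :=
      neg_smul_hamiltonian hA β h
    rw [hd, ← Matrix.map_add _ Complex.ofReal_add] at h1
    have h2 := Matrix.exp_conj U ((β • bridgeSum G + Matrix.diagonal d).map Complex.ofReal) hunit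
    rw [hinv] at h2
    rw [gibbsOp, h1, h2, exp_map_ofReal, Matrix.exp_add_of_commute _ _ hcomm,
      Matrix.exp_diagonal]
    congr 5
    funext s
    rw [Pi.coe_exp, Real.exp_eq_exp_ℝ]
  rw [hexp, Matrix.trace]
  push_cast
  rw [Finset.mul_sum]
  refine Finset.sum_congr rfl fun s _ => ?_
  have hr : (rotationSign A s : ℂ) * rotationSign A s = 1 := by
    exact_mod_cast rotationSign_mul_self A s
  rw [Matrix.diag_apply, Matrix.diagonal_mul, Matrix.mul_diagonal, Matrix.diagonal_mul,
    Matrix.map_apply, Matrix.mul_diagonal, fieldWeight]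
  have hsplit : Real.exp (d s) = Real.exp (-(β / 2 * G.edgeFinset.card)) *
      Real.exp (β * h * ∑ x, spinSign (s x)) := by
    rw [← Real.exp_add]
    congr 1
    ring
  rw [hsplit]
  push_cast
  linear_combination (o s * (NormedSpace.exp (β • bridgeSum G) s s : ℝ) *
    (Complex.exp (-(β / 2 * G.edgeFinset.card)) *
      Complex.exp (β * h * ∑ x, (spinSign (s x) : ℂ)))) * hr

/-- The exponential series of the sum of the bridge matrices, with the powers expanded into products
of bridge matrices. -/
theorem hasSum_bridgeTrace [Fintype V] [DecidableEq V] [DecidableRel G.Adj]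
    (β : ℝ) (F : (V → Fin 2) → ℝ) :
    HasSum (fun k : ℕ => β ^ k / k.factorial * ∑ e : Fin k → G.edgeSet, bridgeTrace F e)
      (∑ s, F s * NormedSpace.exp (β • bridgeSum G) s s) := by
  have h1 : ∀ k : ℕ, β ^ k / k.factorial * ∑ e : Fin k → G.edgeSet, bridgeTrace F e =
      ∑ s, F s * ((k.factorial : ℝ)⁻¹ • (β • bridgeSum G) ^ k) s s := by
    intro k
    unfold bridgeTrace
    rw [Finset.sum_comm]
    simp_rw [← Finset.mul_sum, ← Matrix.sum_apply,
      sum_list_prod_ofFn (fun e : G.edgeSet => bridgeMatrix (e : Sym2 V)) k]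
    rw [Finset.mul_sum]
    refine Finset.sum_congr rfl fun s _ => ?_
    rw [smul_pow, Matrix.smul_apply, Matrix.smul_apply, bridgeSum, smul_eq_mul, smul_eq_mul]
    ring
  simp_rw [h1]
  refine hasSum_sum fun s _ => HasSum.mul_left _ ?_
  have : HasSum (fun k : ℕ => (k.factorial : ℝ)⁻¹ • (β • bridgeSum G) ^ k)
      (NormedSpace.exp (β • bridgeSum G)) := by
    open scoped Matrix.Norms.Operator in
    exact NormedSpace.exp_series_hasSum_exp' (𝕂 := ℝ) _
  exact Pi.hasSum.mp (Pi.hasSum.mp this s) s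

end Hamiltonian

/-! ### The loop representation -/

section Representation

variable {V : Type*} [Fintype V] [DecidableEq V] {G : SimpleGraph V} {A : Set V} {β : ℝ}

/-- The product of the matrices of the bridges has nonnegative entries. -/
theorem abs_bridgeTrace_le {k : ℕ} (F : (V → Fin 2) → ℝ) (e : Fin k → G.edgeSet) :
    |bridgeTrace F e| ≤ bridgeTrace (fun s => |F s|) e := by
  classical
  rw [bridgeTrace_eq_sum_paths, bridgeTrace_eq_sum_paths]
  exact Finset.abs_sum_le_sum_abs _ _

variable [DecidableRel G.Adj]

/-- The integral of a function that, for ordered bridges, is the weighted trace of the product of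
their matrices. -/
theorem integral_bridgeTrace (hβ : 0 < β) {f : BridgeConfig G → ℝ} {F : (V → Fin 2) → ℝ}
    (hf : ∀ k (e : Fin k → G.edgeSet) t, t ∈ orderedTimes k β → f ⟨k, e, t⟩ = bridgeTrace F e) :
    Integrable f (poissonEdgeMeasure G β) ∧
      ∫ ω, f ω ∂(poissonEdgeMeasure G β) = Real.exp (-(β * G.edgeFinset.card)) *
        ∑ s, F s * NormedSpace.exp (β • bridgeSum G) s s := by
  obtain ⟨h1, h2⟩ := hasSum_integral_poissonEdgeMeasure (g := fun _ e => bridgeTrace F e) hβ hf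
    (Summable.of_nonneg_of_le
      (fun k => mul_nonneg (by positivity) (Finset.sum_nonneg fun e _ => abs_nonneg _))
      (fun k => mul_le_mul_of_nonneg_left (Finset.sum_le_sum fun e _ => abs_bridgeTrace_le F e)
        (by positivity)) (hasSum_bridgeTrace (G := G) β fun s => |F s|).summable)
  exact ⟨h1, h2.unique ((hasSum_bridgeTrace β F).mul_left _)⟩

/-- The loop representation of observables that are diagonal in the basis of spin
configurations. -/
theorem trace_diagonal_mul_gibbsOp_eq_integral (hA : G.IsBipartiteWith A Aᶜ) (hβ : 0 < β) (h : ℝ)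
    {f : BridgeConfig G → ℝ} {o : (V → Fin 2) → ℝ} {c : ℝ}
    (hf : ∀ k (e : Fin k → G.edgeSet) t, t ∈ orderedTimes k β →
      f ⟨k, e, t⟩ = bridgeTrace (fun s => c * o s * fieldWeight β h s) e) (hc : c * c = 1) :
    Integrable f (poissonEdgeMeasure G β) ∧
      (Matrix.diagonal (fun s => (o s : ℂ)) * gibbsOp G (2 * β) h).trace =
        ((c * Real.exp (β / 2 * G.edgeFinset.card) *
          ∫ ω, f ω ∂(poissonEdgeMeasure G β) : ℝ) : ℂ) := by
  obtain ⟨h1, h2⟩ := integral_bridgeTrace hβ hf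
  refine ⟨h1, ?_⟩
  rw [trace_diagonal_mul_gibbsOp hA, h2]
  -- the constant in `-2 S_u · S_v` and the normalization of the Poisson law combine
  have hexp : Real.exp (-(β / 2 * G.edgeFinset.card)) =
      Real.exp (β / 2 * G.edgeFinset.card) * Real.exp (-(β * G.edgeFinset.card)) := by
    rw [← Real.exp_add]
    congr 1
    ring
  have hsum : ∑ s, c * o s * fieldWeight β h s * NormedSpace.exp (β • bridgeSum G) s s =
      c * ∑ s, o s * fieldWeight β h s * NormedSpace.exp (β • bridgeSum G) s s := by
    rw [Finset.mul_sum]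
    refine Finset.sum_congr rfl fun s _ => ?_
    ring
  rw [hexp, hsum]
  congr 1
  linear_combination (-(Real.exp (β / 2 * G.edgeFinset.card) *
    Real.exp (-(β * G.edgeFinset.card)) *
    ∑ s, o s * fieldWeight β h s * NormedSpace.exp (β • bridgeSum G) s s)) * hc

theorem partitionFunction_eq (hA : G.IsBipartiteWith A Aᶜ) (hβ : 0 < β) (h : ℝ) :
    Integrable (fun ω => loopWeight A β h ω) (poissonEdgeMeasure G β) ∧
      partitionFunction G (2 * β) h =
        ((Real.exp (β / 2 * G.edgeFinset.card) *
          ∫ ω, loopWeight A β h ω ∂(poissonEdgeMeasure G β) : ℝ) : ℂ) := by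
  have := trace_diagonal_mul_gibbsOp_eq_integral (f := fun ω => loopWeight A β h ω)
    (o := fun _ => 1) (c := 1) hA hβ h
    (fun k e t ht => by simpa using loopWeight_eq hA hβ h ht) (one_mul 1)
  simpa [partitionFunction] using this

theorem trace_spin₃_mul_gibbsOp (hA : G.IsBipartiteWith A Aᶜ) (hβ : 0 < β) (h : ℝ) (x : V) :
    Integrable (fun ω => tanhAt A β h ω x * loopWeight A β h ω) (poissonEdgeMeasure G β) ∧
      (spin₃ x * gibbsOp G (2 * β) h).trace =
        ((1 / 2 * (sgn A x : ℝ) * Real.exp (β / 2 * G.edgeFinset.card) *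
          ∫ ω, tanhAt A β h ω x * loopWeight A β h ω ∂(poissonEdgeMeasure G β) : ℝ) : ℂ) := by
  obtain ⟨h1, h2⟩ := trace_diagonal_mul_gibbsOp_eq_integral
    (f := fun ω => tanhAt A β h ω x * loopWeight A β h ω)
    (o := fun s => spinSign (s x)) (c := sgn A x) hA hβ h
    (fun k e t ht => tanhAt_mul_loopWeight_eq hA hβ h ht x) (sgn_mul_self A x)
  refine ⟨h1, ?_⟩
  have : spin₃ x = (1 / 2 : ℂ) • Matrix.diagonal fun s : V → Fin 2 => (spinSign (s x) : ℂ) := by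
    rw [spin₃_eq, ← Matrix.diagonal_smul]
    rfl
  rw [this, Matrix.smul_mul, Matrix.trace_smul, h2]
  push_cast
  rw [smul_eq_mul]
  ring

theorem trace_spin₃_mul_spin₃_mul_gibbsOp (hA : G.IsBipartiteWith A Aᶜ) (hβ : 0 < β) (h : ℝ)
    (x y : V) :
    Integrable (fun ω => loopWeight A β h ω * pairFactor A β h ω x y) (poissonEdgeMeasure G β) ∧
      (spin₃ x * spin₃ y * gibbsOp G (2 * β) h).trace =
        ((1 / 4 * (sgn A x : ℝ) * (sgn A y : ℝ) * Real.exp (β / 2 * G.edgeFinset.card) *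
          ∫ ω, loopWeight A β h ω * pairFactor A β h ω x y ∂(poissonEdgeMeasure G β) : ℝ) : ℂ) := by
  obtain ⟨h1, h2⟩ := trace_diagonal_mul_gibbsOp_eq_integral
    (f := fun ω => loopWeight A β h ω * pairFactor A β h ω x y)
    (o := fun s => spinSign (s x) * spinSign (s y)) (c := sgn A x * sgn A y) hA hβ h
    (fun k e t ht => loopWeight_mul_pairFactor_eq hA hβ h ht x y)
    (by linear_combination (sgn A y * sgn A y : ℝ) * sgn_mul_self A x + sgn_mul_self A y)
  refine ⟨h1, ?_⟩
  have : spin₃ x * spin₃ y = (1 / 4 : ℂ) •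
      Matrix.diagonal fun s : V → Fin 2 => ((spinSign (s x) * spinSign (s y) : ℝ) : ℂ) := by
    rw [spin₃_eq, spin₃_eq, Matrix.diagonal_mul_diagonal, ← Matrix.diagonal_smul]
    congr 1
    funext s
    simp only [Pi.smul_apply, smul_eq_mul]
    push_cast
    ring
  rw [this, Matrix.smul_mul, Matrix.trace_smul, h2]
  push_cast
  rw [smul_eq_mul]
  ring

end Representation

/-! ### Zero field -/

section ZeroField

variable {V : Type*} [Fintype V] {G : SimpleGraph V} {A : Set V} {β : ℝ}

theorem loopWeight_zero_field {ω : BridgeConfig G} [Finite (Loops A β ω)] :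
    loopWeight A β 0 ω = 2 ^ Nat.card (Loops A β ω) := by
  have := Fintype.ofFinite (Loops A β ω)
  rw [loopWeight_eq_prod]
  simp

open Classical in
theorem pairFactor_zero_field (ω : BridgeConfig G) (x y : V) :
    pairFactor A β 0 ω x y = if loopAt A β ω x = loopAt A β ω y then 1 else 0 := by
  simp [pairFactor, tanhAt]

variable [DecidableRel G.Adj]

/-- For ordered bridges there are finitely many loops, so that `Nat.card` is their true number. -/
theorem ae_two_pow_card_loops (hA : G.IsBipartiteWith A Aᶜ) (hβ : 0 < β) :
    ∀ᵐ ω ∂(poissonEdgeMeasure G β),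
      0 < loopWeight A β 0 ω ∧
        (2 : ℝ≥0∞) ^ Nat.card (Loops A β ω) = ENNReal.ofReal (loopWeight A β 0 ω) := by
  filter_upwards [ae_orderedTimes G β] with ω hω
  have := finite_loops (e := ω.2.1) hA hβ hω
  rw [loopWeight_zero_field]
  refine ⟨by positivity, ?_⟩
  rw [ENNReal.ofReal_pow zero_le_two, ENNReal.ofReal_ofNat]

variable [DecidableEq V]

/-- Up to a null set, the event that two sites lie on the same loop at time `0` is the set where the
integrand of the two-point function at zero field is nonzero. -/
theorem nullMeasurableSet_loopAt_eq (hA : G.IsBipartiteWith A Aᶜ) (hβ : 0 < β) (x y : V) :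
    NullMeasurableSet {ω : BridgeConfig G | loopAt A β ω x = loopAt A β ω y}
      (poissonEdgeMeasure G β) := by
  have h1 := (trace_spin₃_mul_spin₃_mul_gibbsOp hA hβ 0 x y).1.aestronglyMeasurable.aemeasurable
  refine (h1.nullMeasurable (measurableSet_singleton (0 : ℝ)).compl).congr ?_
  filter_upwards [ae_two_pow_card_loops hA hβ] with ω hω
  refine propext ?_
  change loopWeight A β 0 ω * pairFactor A β 0 ω x y ≠ 0 ↔ loopAt A β ω x = loopAt A β ω y
  rw [pairFactor_zero_field]
  simp [hω.1.ne']

/-- At zero field the weight of `loopMeasure` is the loop weight, and the pair factor is the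
indicator of the event that the two sites lie on the same loop. -/
theorem loopMeasure_real_loopAt_eq (hA : G.IsBipartiteWith A Aᶜ) (hβ : 0 < β) (x y : V) :
    (loopMeasure A G β).real {ω | loopAt A β ω x = loopAt A β ω y} =
      (∫ ω, loopWeight A β 0 ω * pairFactor A β 0 ω x y ∂(poissonEdgeMeasure G β)) /
        ∫ ω, loopWeight A β 0 ω ∂(poissonEdgeMeasure G β) := by
  have hae := ae_two_pow_card_loops hA hβ
  have hpos : 0 ≤ᵐ[poissonEdgeMeasure G β] fun ω => loopWeight A β 0 ω := by
    filter_upwards [hae] with ω hω using hω.1.le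
  have hpos' : 0 ≤ᵐ[poissonEdgeMeasure G β]
      fun ω => loopWeight A β 0 ω * pairFactor A β 0 ω x y := by
    filter_upwards [hae] with ω hω
    rw [pairFactor_zero_field]
    split_ifs
    · simpa using hω.1.le
    · simp
  have h1 : ∫⁻ ω, 2 ^ Nat.card (Loops A β ω) ∂(poissonEdgeMeasure G β) =
      ENNReal.ofReal (∫ ω, loopWeight A β 0 ω ∂(poissonEdgeMeasure G β)) := by
    rw [ofReal_integral_eq_lintegral_ofReal (partitionFunction_eq hA hβ 0).1 hpos]
    exact lintegral_congr_ae (hae.mono fun ω hω => hω.2)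
  have h2 : ∫⁻ ω in {ω | loopAt A β ω x = loopAt A β ω y}, 2 ^ Nat.card (Loops A β ω)
      ∂(poissonEdgeMeasure G β) =
      ENNReal.ofReal (∫ ω, loopWeight A β 0 ω * pairFactor A β 0 ω x y
        ∂(poissonEdgeMeasure G β)) := by
    rw [ofReal_integral_eq_lintegral_ofReal (trace_spin₃_mul_spin₃_mul_gibbsOp hA hβ 0 x y).1 hpos',
      ← lintegral_indicator₀ (nullMeasurableSet_loopAt_eq hA hβ x y)]
    refine lintegral_congr_ae (hae.mono fun ω hω => ?_)
    dsimp only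
    rw [pairFactor_zero_field]
    by_cases hxy : loopAt A β ω x = loopAt A β ω y
    · rw [Set.indicator_of_mem (by exact hxy), if_pos hxy, mul_one]
      exact hω.2
    · rw [Set.indicator_of_notMem (by exact hxy), if_neg hxy, mul_zero,
        ENNReal.ofReal_zero]
  -- `withDensity_apply'` holds for every set, because the Poisson edge measure is s-finite
  rw [measureReal_def, loopMeasure, Measure.smul_apply, withDensity_apply', h1, h2, smul_eq_mul,
    ENNReal.toReal_mul, ENNReal.toReal_inv, ENNReal.toReal_ofReal (integral_nonneg_of_ae hpos),
    ENNReal.toReal_ofReal (integral_nonneg_of_ae hpos'), mul_comm, div_eq_mul_inv]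

theorem sgn_mul_gibbsState_zero_field (hA : G.IsBipartiteWith A Aᶜ) (hβ : 0 < β) (x y : V) :
    (sgn A x : ℂ) * (sgn A y : ℂ) * gibbsState G (2 * β) 0 (spin₃ x * spin₃ y) =
      ((1 / 4 * (loopMeasure A G β).real {ω | loopAt A β ω x = loopAt A β ω y} : ℝ) : ℂ) := by
  rw [loopMeasure_real_loopAt_eq hA hβ, gibbsState, (partitionFunction_eq hA hβ 0).2,
    (trace_spin₃_mul_spin₃_mul_gibbsOp hA hβ 0 x y).2]
  have hx : (sgn A x : ℂ) * sgn A x = 1 := by exact_mod_cast sgn_mul_self A x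
  have hy : (sgn A y : ℂ) * sgn A y = 1 := by exact_mod_cast sgn_mul_self A y
  have hexp : (Real.exp (β / 2 * G.edgeFinset.card) : ℂ) ≠ 0 := by
    exact_mod_cast (Real.exp_pos _).ne'
  set I : ℝ := ∫ ω, loopWeight A β 0 ω * pairFactor A β 0 ω x y ∂(poissonEdgeMeasure G β)
  set E : ℝ := Real.exp (β / 2 * G.edgeFinset.card)
  have hnum : ((1 / 4 * (sgn A x : ℝ) * (sgn A y : ℝ) * E * I : ℝ) : ℂ) =
      E * ((sgn A x : ℂ) * sgn A y * (1 / 4 * I)) := by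
    push_cast
    ring
  rw [hnum, Complex.ofReal_mul, mul_div_mul_left _ _ hexp]
  push_cast
  linear_combination (1 / 4 * I / (∫ ω, loopWeight A β 0 ω ∂(poissonEdgeMeasure G β) : ℝ) : ℂ) *
    ((sgn A y * sgn A y : ℂ) * hx + hy)

end ZeroField

end Heisenberg

end

theorem mainTheorem4 {V : Type*} [Fintype V] [DecidableEq V]
    (G : SimpleGraph V) [DecidableRel G.Adj]
    (A : Set V) (hA : G.IsBipartiteWith A Aᶜ) (β h : ℝ) (hβ : 0 < β) :
    (Integrable (fun ω => Heisenberg.loopWeight A β h ω) (Heisenberg.poissonEdgeMeasure G β) ∧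
      Heisenberg.partitionFunction G (2 * β) h =
        ((Real.exp (β / 2 * (G.edgeFinset.card : ℝ)) *
          ∫ ω, Heisenberg.loopWeight A β h ω ∂(Heisenberg.poissonEdgeMeasure G β) : ℝ) : ℂ)) ∧
    (∀ x : V,
      Integrable (fun ω => Heisenberg.tanhAt A β h ω x * Heisenberg.loopWeight A β h ω)
        (Heisenberg.poissonEdgeMeasure G β) ∧
      (Heisenberg.spin₃ x * Heisenberg.gibbsOp G (2 * β) h).trace =
        ((1 / 2 * (Heisenberg.sgn A x : ℝ) * Real.exp (β / 2 * (G.edgeFinset.card : ℝ)) *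
          ∫ ω, Heisenberg.tanhAt A β h ω x * Heisenberg.loopWeight A β h ω
            ∂(Heisenberg.poissonEdgeMeasure G β) : ℝ) : ℂ)) ∧
    (∀ x y : V,
      Integrable (fun ω => Heisenberg.loopWeight A β h ω * Heisenberg.pairFactor A β h ω x y)
        (Heisenberg.poissonEdgeMeasure G β) ∧
      (Heisenberg.spin₃ x * Heisenberg.spin₃ y * Heisenberg.gibbsOp G (2 * β) h).trace =
        ((1 / 4 * (Heisenberg.sgn A x : ℝ) * (Heisenberg.sgn A y : ℝ) *
          Real.exp (β / 2 * (G.edgeFinset.card : ℝ)) *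
          ∫ ω, Heisenberg.loopWeight A β h ω * Heisenberg.pairFactor A β h ω x y
            ∂(Heisenberg.poissonEdgeMeasure G β) : ℝ) : ℂ)) ∧
    (∀ x y : V,
      (Heisenberg.sgn A x : ℂ) * (Heisenberg.sgn A y : ℂ) *
          Heisenberg.gibbsState G (2 * β) 0 (Heisenberg.spin₃ x * Heisenberg.spin₃ y) =
        ((1 / 4 * (Heisenberg.loopMeasure A G β).real
          {ω | Heisenberg.loopAt A β ω x = Heisenberg.loopAt A β ω y} : ℝ) : ℂ)) :=
  ⟨Heisenberg.partitionFunction_eq hA hβ h, Heisenberg.trace_spin₃_mul_gibbsOp hA hβ h,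
    Heisenberg.trace_spin₃_mul_spin₃_mul_gibbsOp hA hβ h,
    Heisenberg.sgn_mul_gibbsState_zero_field hA hβ⟩
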